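/- Conventions. A locally compact group $G$ is a \emph{cocompact envelope} of a group $\Gamma$ if $G$ contains a subgroup isomorphic to $\Gamma$ that is discrete and cocompact, i.e. closed and such that $\Gamma K = G$ for some compact $K \subseteq G$; two groups \emph{share a cocompact envelope} if some locally compact group is a cocompact envelope of both. For $n \geq 2$ let $T_n$ be the $(n+1)$-regular tree, with a fixed end and an associated Busemann function $b : T_n \to \mathbb{Z}$. The Diestel–Leader graph $\mathrm{DL}_2(n)$ has vertex set $\{(x_1,x_2) \in T_n \times T_n : b(x_1)+b(x_2)=0\}$, with $(x_1,x_2)$ adjacent to $(x_1',x_2')$ if and only if $x_1 \sim x_1'$ and $x_2 \sim x_2'$. The isometry groups $\mathrm{Isom}(\mathbb{R}^2)$ (Euclidean metric) and $\mathrm{Isom}(\mathrm{DL}_2(n))$ (graph metric) carry the topology of pointwise convergence. $F \wr \mathbb{Z} = \big(\bigoplus_{\mathbb{Z}} F\big) \rtimes \mathbb{Z}$ is the restricted wreath product. A solvable group has \emph{finite rank} if there is an integer $k$ such that each of its finitely generated subgroups can be generated by at most $k$ elements. A group is \emph{virtually solvable} if it has a solvable subgroup of finite index. Theorem. (a) For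 every $n \geq 2$ there is a finitely generated group of the form $\Gamma = \mathbb{Z}[1/n]^2 \rtimes \mathbb{Z}$ such that for every finite group $F$ of cardinality $n$, the locally compact group $\mathrm{Isom}(\mathbb{R}^2) \times \mathrm{Isom}(\mathrm{DL}_2(n))$ is a cocompact envelope of both $\Gamma$ and $\Lambda = \mathbb{Z}^2 \times (F \wr \mathbb{Z})$. (b) There exist finitely generated groups $\Gamma$ and $\Lambda$ that share a cocompact envelope, with $\Gamma$ solvable of finite rank and $\Lambda$ not virtually solvable. -/

import Mathlib

open scoped ENNReal

/-! ## Envelopes -/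

/-- `G` is a locally compact (Hausdorff topological) group that contains a copy of the discrete
group `Γ` as a discrete and cocompact subgroup; cocompact means closed and cobounded, that is
`Γ K = G` for some compact subset `K` of `G`. -/
def IsCocompactEnvelope (G : Type*) [Group G] [TopologicalSpace G] (Γ : Type*) [Group Γ] : Prop :=
  IsTopologicalGroup G ∧ T2Space G ∧ LocallyCompactSpace G ∧
    ∃ ι : Γ →* G, Function.Injective ι ∧
      DiscreteTopology (ι.range : Set G) ∧ IsClosed (ι.range : Set G) ∧
      ∃ K : Set G, IsCompact K ∧ ∀ g : G, ∃ γ : Γ, ∃ k ∈ K, g = ι γ * k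

/-- `Γ` and `Λ` share a cocompact envelope. -/
def ShareCocompactEnvelope (Γ Λ : Type*) [Group Γ] [Group Λ] : Prop :=
  ∃ (G : Type) (_ : Group G) (_ : TopologicalSpace G),
    IsCocompactEnvelope G Γ ∧ IsCocompactEnvelope G Λ

/-! ## Group-theoretic notions -/

/-- There is `k` such that every finitely generated subgroup can be generated by at most `k`
elements. -/
def HasFiniteRank (Γ : Type*) [Group Γ] : Prop :=
  ∃ k : ℕ, ∀ H : Subgroup Γ, H.FG → ∃ S : Finset Γ, S.card ≤ k ∧ Subgroup.closure (S : Set Γ) = H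

/-- There is a solvable subgroup of finite index. -/
def IsVirtuallySolvable (Γ : Type*) [Group Γ] : Prop :=
  ∃ H : Subgroup Γ, Group.IsSolvable H ∧ H.FiniteIndex

/-- The restricted wreath product `F ≀ Q = (⨁_Q F) ⋊ Q`: the elements of the unrestricted one
whose function `Q → F` is finitely supported. -/
def restrictedWreath (F Q : Type*) [Group F] [Group Q] : Subgroup (F ≀ᵣ Q) where
  carrier := {a | (Function.mulSupport a.left).Finite}
  one_mem' := by simp
  mul_mem' := by
    intro a b ha hb
    have hb' : (Function.mulSupport fun x => b.left (a.right⁻¹ * x)).Finite :=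
      hb.preimage (f := fun x => a.right⁻¹ * x) (mul_right_injective _).injOn
    exact (ha.union hb').subset (Function.mulSupport_mul _ _)
  inv_mem' := by
    intro a ha
    have h := ha.preimage (f := fun x => a.right * x) (mul_right_injective _).injOn
    refine h.subset fun x hx => ?_
    simpa using hx

/-- The subring `ℤ[1/n]` of `ℚ`. -/
abbrev ZInv (n : ℕ) : Subalgebra ℤ ℚ := Algebra.adjoin ℤ {(n : ℚ)⁻¹}

/-- The semidirect product `ℤ[1/n]² ⋊ ℤ` for an action `φ` of `ℤ` on `ℤ[1/n]²`. -/
abbrev ZInvSqSemidirect (n : ℕ)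
    (φ : Multiplicative ℤ →* MulAut (Multiplicative (Fin 2 → ZInv n))) : Type :=
  Multiplicative (Fin 2 → ZInv n) ⋊[φ] Multiplicative ℤ

/-- The group `ℤ² × (F ≀ ℤ)`. -/
abbrev ZSqTimesLamplighter (F : Type*) [Group F] :=
  Multiplicative (Fin 2 → ℤ) × restrictedWreath F (Multiplicative ℤ)

/-! ## Isometry groups -/

/-- The isometry group of a metric space carries the topology of pointwise convergence (on
isometries it is the compact-open topology). -/
instance isometryGroupTopology (X : Type*) [PseudoEMetricSpace X] : TopologicalSpace (X ≃ᵢ X) :=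
  TopologicalSpace.induced (fun f => (f : X → X)) inferInstance

/-- The vertex set of a graph, seen as a metric space. -/
def MetricGraph {V : Type*} (_ : SimpleGraph V) := V

/-- The distance is the graph metric. -/
noncomputable instance {V : Type*} (T : SimpleGraph V) : EMetricSpace (MetricGraph T) where
  edist x y := (T.edist (V := V) x y : ℝ≥0∞)
  edist_self x := by
    have h : T.edist (V := V) x x = 0 := SimpleGraph.edist_self
    rw [h]; simp
  edist_comm x y := by
    have h : T.edist (V := V) x y = T.edist (V := V) y x := SimpleGraph.edist_comm
    rw [h]
  edist_triangle x y z := by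
    have h : T.edist (V := V) x z ≤ T.edist (V := V) x y + T.edist (V := V) y z :=
      SimpleGraph.edist_triangle
    rw [← ENat.toENNReal_add]
    exact ENat.toENNReal_le.2 h
  eq_of_edist_eq_zero {x y} h :=
    SimpleGraph.edist_eq_zero_iff.1 (ENat.toENNReal_eq_zero.1 h)

/-! ## The regular tree with a distinguished end -/

/-- A geodesic ray in a graph. -/
def IsGeodesicRay {V : Type*} (T : SimpleGraph V) (ξ : ℕ → V) : Prop :=
  ∀ i j : ℕ, (T.dist (ξ i) (ξ j) : ℤ) = |(i : ℤ) - j|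

/-- `b` is a Busemann function associated to the end of the ray `ξ`: up to an additive constant,
`b v` is the limit of `d (v, ξ t) - t`. -/
def IsBusemann {V : Type*} (T : SimpleGraph V) (ξ : ℕ → V) (b : V → ℤ) : Prop :=
  ∃ c : ℤ, ∀ v, ∀ᶠ t : ℕ in Filter.atTop, (T.dist v (ξ t) : ℤ) - t = b v + c

/-- A vertex of the `(n + 1)`-regular tree `T_n`: its height `k`, and a finitely supported sequence
of digits in `{0, …, n - 1}` at the positions below `k`. -/
@[ext] structure TreeVertex (n : ℕ) where
  height : ℤ
  digit : ℤ →₀ ℕ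
  digit_lt : ∀ i, digit i < n
  digit_eq_zero : ∀ i, height ≤ i → digit i = 0

namespace TreeVertex

variable {n : ℕ}

/-- The neighbour towards the distinguished end: forget the top digit. -/
noncomputable def parent (v : TreeVertex n) : TreeVertex n where
  height := v.height - 1
  digit := v.digit.erase (v.height - 1)
  digit_lt i := by
    have h := v.digit_lt i
    rw [Finsupp.erase_apply]
    split_ifs <;> omega
  digit_eq_zero i hi := by
    have h := v.digit_eq_zero i
    rw [Finsupp.erase_apply]
    split_ifs
    · rfl
    · exact h (by omega)

@[simp] lemma height_parent (v : TreeVertex n) : v.parent.height = v.height - 1 := rfl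

end TreeVertex

/-- The tree `T_n`: every vertex is joined to its parent. -/
def regularTree (n : ℕ) : SimpleGraph (TreeVertex n) where
  Adj v w := w = v.parent ∨ v = w.parent
  symm := ⟨fun _ _ h => h.symm⟩
  loopless := ⟨fun v h => by
    have h' : v = v.parent := by simpa using h
    have := congrArg TreeVertex.height h'
    rw [TreeVertex.height_parent] at this
    omega⟩

/-! ## Diestel–Leader graphs -/

/-- The horocyclic product of two graphs `T₁`, `T₂` with respect to `b₁`, `b₂`. -/
def horocyclicProduct {V₁ V₂ : Type*} (T₁ : SimpleGraph V₁) (T₂ : SimpleGraph V₂)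
    (b₁ : V₁ → ℤ) (b₂ : V₂ → ℤ) : SimpleGraph {x : V₁ × V₂ // b₁ x.1 + b₂ x.2 = 0} where
  Adj x y := T₁.Adj x.1.1 y.1.1 ∧ T₂.Adj x.1.2 y.1.2
  symm := ⟨fun _ _ h => ⟨h.1.symm, h.2.symm⟩⟩
  loopless := ⟨fun _ h => T₁.loopless.irrefl _ h.1⟩

/-- The Diestel–Leader graph `DL₂(n)`. -/
abbrev diestelLeader (n : ℕ) :=
  horocyclicProduct (regularTree n) (regularTree n) TreeVertex.height TreeVertex.height

/-- The group `Isom(ℝ²) × Isom(DL₂(n))`, with the product topology. -/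
abbrev IsomR2TimesIsomDL (n : ℕ) : Type :=
  (EuclideanSpace ℝ (Fin 2) ≃ᵢ EuclideanSpace ℝ (Fin 2)) ×
    (MetricGraph (diestelLeader n) ≃ᵢ MetricGraph (diestelLeader n))

/-! ## The model of `T_n` is the `(n + 1)`-regular tree, and the height is a Busemann function -/

namespace TreeVertex

variable {n : ℕ}

/-- The ray `(0, -1, -2, …)` with all digits zero, defining the distinguished end. -/
def ray (hn : 0 < n) (t : ℕ) : TreeVertex n where
  height := -t
  digit := 0
  digit_lt _ := hn
  digit_eq_zero _ _ := rfl

lemma height_iterate_parent (v : TreeVertex n) (k : ℕ) :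
    (parent^[k] v).height = v.height - k := by
  induction k with
  | zero => simp
  | succ k ih => rw [Function.iterate_succ_apply', height_parent, ih]; push_cast; ring

lemma digit_iterate_parent (v : TreeVertex n) (k : ℕ) (i : ℤ) :
    (parent^[k] v).digit i = if i < v.height - k then v.digit i else 0 := by
  induction k with
  | zero =>
    have := v.digit_eq_zero i
    simp only [Function.iterate_zero, id_eq, Nat.cast_zero, sub_zero]
    split_ifs with h
    · rfl
    · exact this (by omega)
  | succ k ih =>
    rw [Function.iterate_succ_apply']
    simp only [parent, Finsupp.erase_apply, height_iterate_parent, ih]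
    push_cast
    split_ifs <;> first | rfl | omega

/-- Going up from `v` reaches the distinguished ray. -/
lemma eventually_iterate_parent (hn : 0 < n) (v : TreeVertex n) :
    ∀ᶠ t : ℕ in Filter.atTop, ∃ k : ℕ, (k : ℤ) = v.height + t ∧ parent^[k] v = ray hn t := by
  obtain ⟨m, hm⟩ : ∃ m : ℕ, ∀ i ∈ v.digit.support, -(m : ℤ) ≤ i := by
    obtain ⟨b, hb⟩ := v.digit.support.bddBelow
    refine ⟨b.natAbs, fun i hi => ?_⟩
    have := hb hi
    omega
  filter_upwards [Filter.eventually_ge_atTop (m + v.height.natAbs)] with t ht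
  refine ⟨(v.height + t).toNat, by omega, ?_⟩
  have hk : (((v.height + t).toNat : ℕ) : ℤ) = v.height + t := by omega
  ext i
  · rw [height_iterate_parent, hk]; simp [ray]
  · rw [digit_iterate_parent, hk]
    simp only [ray, Finsupp.coe_zero, Pi.zero_apply, ite_eq_right_iff]
    intro hi
    by_contra h
    have := hm i (Finsupp.mem_support_iff.2 h)
    omega

end TreeVertex

open TreeVertex in
lemma regularTree_walk_up {n : ℕ} (v : TreeVertex n) (k : ℕ) :
    ∃ p : (regularTree n).Walk v (parent^[k] v), p.length = k := by
  induction k with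
  | zero => exact ⟨.nil, rfl⟩
  | succ k ih =>
    obtain ⟨p, hp⟩ := ih
    rw [Function.iterate_succ_apply']
    have h : (regularTree n).Adj (parent^[k] v) (parent^[k] v).parent := Or.inl rfl
    exact ⟨p.concat h, by rw [SimpleGraph.Walk.length_concat, hp]⟩

open TreeVertex in
lemma regularTree_connected {n : ℕ} (hn : 0 < n) : (regularTree n).Connected := by
  have : Nonempty (TreeVertex n) := ⟨ray hn 0⟩
  refine SimpleGraph.Connected.mk fun v w => ?_
  obtain ⟨t, ⟨k, -, hk⟩, ⟨l, -, hl⟩⟩ :=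
    ((eventually_iterate_parent hn v).and (eventually_iterate_parent hn w)).exists
  obtain ⟨p, -⟩ := regularTree_walk_up v k
  obtain ⟨q, -⟩ := regularTree_walk_up w l
  exact (hk ▸ p).reachable.trans (hl ▸ q).reachable.symm

/-- `T_n` is a tree. -/
lemma regularTree_isTree {n : ℕ} (hn : 0 < n) : (regularTree n).IsTree := by
  classical
  refine ⟨regularTree_connected hn, fun u c hc => ?_⟩
  obtain ⟨v, hv, hmax⟩ := c.support.toFinset.exists_max_image TreeVertex.height
    ⟨u, by simp⟩
  rw [List.mem_toFinset] at hv
  have hc' := hc.rotate hv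
  have key : ∀ w ∈ (c.rotate v hv).support, (regularTree n).Adj v w → w = v.parent := by
    intro w hw h
    rcases h with h | h
    · exact h
    · have := hmax w (by
        rw [List.mem_toFinset]
        exact (SimpleGraph.Walk.mem_support_rotate_iff _ _ hv).1 hw)
      have h2 := congrArg TreeVertex.height h
      simp at h2
      omega
  refine hc'.snd_ne_penultimate ?_
  exact (key _ (SimpleGraph.Walk.getVert_mem_support _ _)
      ((c.rotate v hv).adj_snd hc'.not_nil)).trans
    (key _ (SimpleGraph.Walk.getVert_mem_support _ _)
      ((c.rotate v hv).adj_penultimate hc'.not_nil).symm).symm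

namespace TreeVertex

variable {n : ℕ}

/-- The child of `v` obtained by adding the top digit `d`. -/
noncomputable def child (v : TreeVertex n) (d : Fin n) : TreeVertex n where
  height := v.height + 1
  digit := v.digit.update v.height d
  digit_lt i := by
    have h := v.digit_lt i
    rw [Finsupp.update_apply]
    split_ifs <;> omega
  digit_eq_zero i hi := by
    have h := v.digit_eq_zero i
    rw [Finsupp.update_apply]
    split_ifs <;> omega

lemma child_injective (v : TreeVertex n) : Function.Injective v.child := by
  intro d e h
  have := congrArg (fun w => w.digit v.height) h
  simp only [child, Finsupp.update_apply, if_true] at this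
  exact Fin.ext this

lemma eq_parent_iff (v w : TreeVertex n) : v = w.parent ↔ w ∈ Set.range v.child := by
  constructor
  · rintro rfl
    refine ⟨⟨w.digit (w.height - 1), w.digit_lt _⟩, ?_⟩
    ext i
    · simp [child]
    · simp only [child, parent, Finsupp.update_apply, Finsupp.erase_apply]
      split_ifs with h
      · rw [h]
      · rfl
  · rintro ⟨d, rfl⟩
    ext i
    · simp [child]
    · have := v.digit_eq_zero i
      simp only [child, parent, Finsupp.update_apply, Finsupp.erase_apply, add_sub_cancel_right]
      split_ifs with h
      · exact this h.ge
      · rfl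

end TreeVertex

/-- Every vertex of `T_n` has degree `n + 1`. -/
lemma regularTree_degree {n : ℕ} (v : TreeVertex n) :
    ((regularTree n).neighborSet v).ncard = n + 1 := by
  have h : (regularTree n).neighborSet v = insert v.parent (Set.range v.child) := by
    ext w
    simp only [SimpleGraph.mem_neighborSet, Set.mem_insert_iff, ← TreeVertex.eq_parent_iff]
    rfl
  rw [h, Set.ncard_insert_of_notMem _ (Set.finite_range _), ← Set.image_univ,
    Set.ncard_image_of_injective _ v.child_injective, Set.ncard_univ, Nat.card_fin]
  rintro ⟨d, hd⟩
  have := congrArg TreeVertex.height hd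
  simp [TreeVertex.child] at this
  omega

lemma regularTree_abs_le_dist {n : ℕ} (hn : 0 < n) (v w : TreeVertex n) :
    |v.height - w.height| ≤ (regularTree n).dist v w := by
  obtain ⟨p, hp⟩ := (regularTree_connected hn).exists_walk_length_eq_dist v w
  rw [← hp]
  clear hp
  induction p with
  | nil => simp
  | cons h p ih =>
    rw [SimpleGraph.Walk.length_cons]
    push_cast
    rcases h with h | h <;> have h2 := congrArg TreeVertex.height h <;> simp at h2 <;>
      rw [abs_le] at * <;> constructor <;> omega

open TreeVertex in
/-- The all-zero ray is a geodesic ray, and the height is a Busemann function for its end. -/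
lemma height_isBusemann {n : ℕ} (hn : 0 < n) :
    IsGeodesicRay (regularTree n) (ray hn) ∧
      IsBusemann (regularTree n) (ray hn) TreeVertex.height := by
  have hup : ∀ (v w : TreeVertex n) (k : ℕ), parent^[k] v = w →
      (regularTree n).dist v w = k := by
    rintro v w k rfl
    obtain ⟨p, hp⟩ := regularTree_walk_up v k
    have h1 := SimpleGraph.dist_le p
    have h2 := regularTree_abs_le_dist hn v (parent^[k] v)
    rw [height_iterate_parent, abs_le] at h2
    omega
  have hle : ∀ i k : ℕ, (regularTree n).dist (ray hn i) (ray hn (i + k)) = k := by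
    intro i k
    refine hup _ _ k ?_
    ext j
    · rw [height_iterate_parent]; simp [ray]; ring
    · rw [digit_iterate_parent]; exact ite_self (0 : ℕ)
  constructor
  · intro i j
    rcases le_total i j with h | h
    · obtain ⟨k, rfl⟩ := Nat.exists_eq_add_of_le h
      rw [hle]; simp
    · obtain ⟨k, rfl⟩ := Nat.exists_eq_add_of_le h
      rw [SimpleGraph.dist_comm, hle]; simp
  · refine ⟨0, fun v => ?_⟩
    filter_upwards [eventually_iterate_parent hn v] with t ⟨k, hk, h⟩
    rw [hup _ _ k h, hk]; ring

/-! Both groups act on the plane and on the Diestel–Leader graph. By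
`TreeOrbitMap.isCocompactEnvelope` it suffices that the action on the vertices of `DL₂(n)` is
transitive and that the stabilizer of one vertex has a free, discrete and cobounded orbit in the
plane. The target is a locally compact group because balls in both spaces are compact, so that
Tychonoff applies to isometries moving a base point by a bounded amount.

For `ℤ² × (F ≀ ℤ)` the two factors act separately. The first tree records the lamps below the
lamplighter and the second one the remaining lamps, so `F ≀ ℤ` is transitive on `DL₂(n)` with
trivial vertex stabilizers, and `ℤ²` is a lattice of translations.

For the arithmetic group take a nonreal root `ζ` of `n ζ² - ζ + n = 0`. The two roots are conjugate
with product `1`, so `|ζ| = 1` and `ζ` rotates `ℂ`. Since `ζ + ζ⁻¹ = 1/n`, the ring `R = ℤ[ζ, ζ⁻¹]`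
equals `ℤ[1/n] + ℤ[1/n] ζ`, and `Γ` is `R ⋊ ℤ` with `ℤ` acting through powers of `ζ`. For `η = ζ`
and `η = ζ⁻¹` the digits `0, …, n - 1` represent `ℤ[η]` modulo `η` (`exists_digit`,
`natCast_dvd_of_eq_mul`), so the cosets of `η^k ℤ[η]` in `R` are the vertices of `T_n`
(`cosetVertex_eq_iff`). Transitivity on `DL₂(n)` comes from `R = ℤ[ζ] + ℤ[ζ⁻¹]`
(`exists_add_eq_of_mem_adjoin`). The stabilizer of a vertex is the group of translations by `ℤ[ζ] ∩
ℤ[ζ⁻¹] = ℤ + ℤ n ζ` (`exists_eq_add_of_mem_of_mem`), a lattice in `ℂ`.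

Part (b) is the case `F = S₅`: the arithmetic group is metabelian of finite rank, whereas in every
finite quotient of `F ≀ ℤ` two commuting copies of `F` get the same image, which is therefore
abelian (`not_isVirtuallySolvable_of_commute`). -/

section IsometryGroup

/-! ### Isometry groups are Hausdorff topological groups, locally compact when balls are compact. -/

open Topology Filter

variable {X : Type*}

lemma continuous_isometry_apply [PseudoEMetricSpace X] (x : X) :
    Continuous fun f : X ≃ᵢ X => f x :=
  (continuous_apply x).comp continuous_induced_dom

lemma tendsto_isometryGroup_iff [PseudoEMetricSpace X] {ι : Type*} {l : Filter ι}
    {u : ι → X ≃ᵢ X} {f : X ≃ᵢ X} :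
    Tendsto u l (𝓝 f) ↔ ∀ x, Tendsto (fun i => u i x) l (𝓝 (f x)) := by
  rw [nhds_induced, tendsto_comap_iff, tendsto_pi_nhds]
  rfl

/-- Pointwise control suffices because isometries carry errors unchanged: `p.1` preserves the
distance from `p.2 x` to `g x`, and applying `g` turns the distance from `g⁻¹ x` to `f⁻¹ x` into
that from `x` to `g (f⁻¹ x)`. -/
instance isometryGroup_isTopologicalGroup [PseudoEMetricSpace X] :
    IsTopologicalGroup (X ≃ᵢ X) where
  continuous_mul := by
    rw [continuous_iff_continuousAt]
    rintro ⟨f, g⟩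
    rw [ContinuousAt, tendsto_isometryGroup_iff]
    intro x
    rw [tendsto_iff_edist_tendsto_0]
    have h1 : Tendsto (fun p : (X ≃ᵢ X) × (X ≃ᵢ X) => edist (p.2 x) (g x)) (𝓝 (f, g)) (𝓝 0) :=
      tendsto_iff_edist_tendsto_0.1
        (((continuous_isometry_apply x).comp continuous_snd).tendsto (f, g))
    have h2 : Tendsto (fun p : (X ≃ᵢ X) × (X ≃ᵢ X) => edist (p.1 (g x)) (f (g x)))
        (𝓝 (f, g)) (𝓝 0) :=
      tendsto_iff_edist_tendsto_0.1
        (((continuous_isometry_apply (g x)).comp continuous_fst).tendsto (f, g))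
    have h3 := h1.add h2
    rw [add_zero] at h3
    refine tendsto_of_tendsto_of_tendsto_of_le_of_le tendsto_const_nhds h3
      (fun _ => zero_le) fun p => ?_
    refine (edist_triangle _ (p.1 (g x)) _).trans (add_le_add_left (le_of_eq ?_) _)
    exact p.1.edist_eq _ _
  continuous_inv := by
    rw [continuous_iff_continuousAt]
    intro f
    rw [ContinuousAt, tendsto_isometryGroup_iff]
    intro x
    rw [tendsto_iff_edist_tendsto_0]
    have h := tendsto_iff_edist_tendsto_0.1 ((continuous_isometry_apply (f⁻¹ x)).tendsto f)
    refine h.congr fun g => ?_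
    rw [← g.edist_eq (g⁻¹ x)]
    have h1 : f (f⁻¹ x) = x := f.apply_symm_apply x
    have h2 : g (g⁻¹ x) = x := g.apply_symm_apply x
    rw [h1, h2, edist_comm]

instance isometryGroup_t2Space [EMetricSpace X] : T2Space (X ≃ᵢ X) :=
  T2Space.of_injective_continuous (f := fun f : X ≃ᵢ X => (f : X → X)) DFunLike.coe_injective
    continuous_induced_dom

/-- An isometry together with its inverse, as a point of `(X → X) × (X → X)`. -/
def isometryPair [PseudoEMetricSpace X] (f : X ≃ᵢ X) : (X → X) × (X → X) := (f, f.symm)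

/-- The adjunction identity alone forces the two maps to be mutually inverse isometries, and it is a
closed condition for pointwise convergence. -/
lemma range_isometryPair [EMetricSpace X] :
    Set.range (isometryPair (X := X)) = {p | ∀ x y, edist (p.1 x) y = edist x (p.2 y)} := by
  ext p
  constructor
  · rintro ⟨f, rfl⟩ x y
    simpa [isometryPair] using (f.edist_eq x (f.symm y))
  · intro hp
    have h1 : ∀ x, p.2 (p.1 x) = x := fun x => by
      have := hp x (p.1 x)
      rw [edist_self] at this
      exact (edist_eq_zero.1 this.symm).symm
    have h2 : ∀ x, p.1 (p.2 x) = x := fun x => by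
      have := hp (p.2 x) x
      rw [edist_self] at this
      exact edist_eq_zero.1 this
    exact ⟨⟨⟨p.1, p.2, h1, h2⟩, fun x y => by
      change edist (p.1 x) (p.1 y) = _
      rw [hp, h1]⟩, rfl⟩

lemma isClosedEmbedding_isometryPair [EMetricSpace X] :
    IsClosedEmbedding (isometryPair (X := X)) := by
  have hc : Continuous (isometryPair (X := X)) := by
    refine Continuous.prodMk continuous_induced_dom ?_
    exact continuous_induced_dom.comp (continuous_inv (G := X ≃ᵢ X))
  refine ⟨⟨⟨le_antisymm hc.le_induced ?_⟩, ?_⟩, ?_⟩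
  · have h : (isometryGroupTopology X) =
        TopologicalSpace.induced (Prod.fst ∘ isometryPair (X := X)) inferInstance := rfl
    rw [h, ← induced_compose]
    exact induced_mono continuous_fst.le_induced
  · intro f g h
    exact DFunLike.coe_injective (congrArg Prod.fst h)
  · rw [range_isometryPair]
    simp only [Set.ofPred_forall]
    refine isClosed_iInter fun x => isClosed_iInter fun y => isClosed_eq ?_ ?_ <;> fun_prop

/-- If all balls of finite radius are compact, so are the sets of isometries that move a point by
a bounded amount. -/
lemma isCompact_setOf_edist_isometry_le [EMetricSpace X] (x₀ : X)
    (hX : ∀ r : ℝ≥0∞, r ≠ ⊤ → IsCompact {y : X | edist y x₀ ≤ r})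
    (hfin : ∀ x : X, edist x x₀ ≠ ⊤) {r : ℝ≥0∞} (hr : r ≠ ⊤) :
    IsCompact {f : X ≃ᵢ X | edist (f x₀) x₀ ≤ r} := by
  -- Both `f` and its inverse move `x` into the ball of radius `edist x x₀ + r` about `x₀`, so the
  -- pair lies in a product of compact balls.
  have hK : IsCompact (Set.pi Set.univ fun x : X => {y : X | edist y x₀ ≤ edist x x₀ + r}) :=
    isCompact_univ_pi fun x => hX _ (ENNReal.add_ne_top.2 ⟨hfin x, hr⟩)
  refine (isClosedEmbedding_isometryPair.isCompact_preimage (hK.prod hK)).of_isClosed_subset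
    (isClosed_le ((continuous_isometry_apply x₀).edist continuous_const) continuous_const) ?_
  intro f hf
  have hf : edist (f x₀) x₀ ≤ r := hf
  refine ⟨fun x _ => ?_, fun x _ => ?_⟩
  · refine (edist_triangle (f x) (f x₀) x₀).trans (add_le_add (f.edist_eq _ _).le hf)
  · change edist (f.symm x) x₀ ≤ _
    rw [← f.edist_eq, f.apply_symm_apply]
    refine (edist_triangle x x₀ (f x₀)).trans ?_
    rw [edist_comm x₀ (f x₀)]
    gcongr

lemma isometryGroup_locallyCompactSpace [EMetricSpace X] (x₀ : X)
    (hX : ∀ r : ℝ≥0∞, r ≠ ⊤ → IsCompact {y : X | edist y x₀ ≤ r})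
    (hfin : ∀ x : X, edist x x₀ ≠ ⊤) : LocallyCompactSpace (X ≃ᵢ X) := by
  refine (isCompact_setOf_edist_isometry_le x₀ hX hfin
    ENNReal.one_ne_top).locallyCompactSpace_of_mem_nhds_of_group (x := 1) ?_
  have : IsOpen {f : X ≃ᵢ X | edist (f x₀) x₀ < 1} :=
    isOpen_lt ((continuous_isometry_apply x₀).edist continuous_const) continuous_const
  refine Filter.mem_of_superset (this.mem_nhds ?_) fun f (hf : edist (f x₀) x₀ < 1) => hf.le
  change edist x₀ x₀ < 1
  simp

end IsometryGroup

/-! ### Graph automorphisms as isometries, and compact balls in locally finite graphs. -/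

section GraphMetric

variable {V : Type*}

lemma SimpleGraph.edist_map_le {G : SimpleGraph V} (f : G →g G) (x y : V) :
    G.edist (f x) (f y) ≤ G.edist x y := by
  by_cases h : G.Reachable x y
  · obtain ⟨p, hp⟩ := h.exists_walk_length_eq_edist
    rw [← hp, ← SimpleGraph.Walk.length_map f p]
    exact SimpleGraph.edist_le _
  · rw [SimpleGraph.edist_eq_top_of_not_reachable h]
    exact le_top

/-- A group acting by graph automorphisms acts by isometries of the graph metric. -/
def isometryHomOfPermHom {Γ : Type*} [Group Γ] (G : SimpleGraph V) (a : Γ →* Equiv.Perm V)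
    (h : ∀ g x y, G.Adj x y → G.Adj (a g x) (a g y)) :
    Γ →* (MetricGraph G ≃ᵢ MetricGraph G) where
  toFun g := ⟨a g, fun x y => by
    refine congrArg (fun t : ℕ∞ => (t : ℝ≥0∞)) (le_antisymm ?_ ?_)
    · exact SimpleGraph.edist_map_le (G := G) ⟨a g, h g _ _⟩ x y
    · have key (x y : V) : G.edist x y ≤ G.edist (a g x) (a g y) := by
        simpa using SimpleGraph.edist_map_le (G := G) ⟨a g⁻¹, h g⁻¹ _ _⟩ (a g x) (a g y)
      exact key x y⟩
  map_one' := IsometryEquiv.ext fun x => congrFun (congrArg DFunLike.coe (map_one a)) x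
  map_mul' g₁ g₂ :=
    IsometryEquiv.ext fun x => congrFun (congrArg DFunLike.coe (map_mul a g₁ g₂)) x

lemma MetricGraph.edist_def {G : SimpleGraph V} (x y : MetricGraph G) :
    edist x y = ((G.edist (V := V) x y : ℕ∞) : ℝ≥0∞) := rfl

lemma MetricGraph.eq_of_edist_lt_one {G : SimpleGraph V} {x y : MetricGraph G}
    (h : edist x y < 1) : x = y := by
  rw [MetricGraph.edist_def, ← ENat.toENNReal_one, ENat.toENNReal_lt, Order.lt_one_iff] at h
  exact SimpleGraph.edist_eq_zero_iff.1 h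

lemma SimpleGraph.finite_setOf_edist_le {G : SimpleGraph V}
    (hG : ∀ v, (G.neighborSet v).Finite) (x : V) (k : ℕ) : {y | G.edist y x ≤ k}.Finite := by
  induction k with
  | zero =>
    refine (Set.finite_singleton x).subset fun y hy => ?_
    simpa using hy
  | succ k ih =>
    refine (ih.union (ih.biUnion fun z _ => hG z)).subset fun y hy => ?_
    have hy : G.edist y x ≤ (k + 1 : ℕ) := hy
    have hr : G.Reachable y x := by
      by_contra h
      rw [SimpleGraph.edist_eq_top_of_not_reachable h] at hy
      exact absurd hy (by simp)
    obtain ⟨p, hp⟩ := hr.exists_walk_length_eq_edist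
    rw [← hp, Nat.cast_le] at hy
    cases p with
    | nil => left; simp
    | cons h q =>
      rw [SimpleGraph.Walk.length_cons] at hy
      right
      refine Set.mem_biUnion (show _ ∈ _ from ?_) h.symm
      exact (SimpleGraph.edist_le q).trans (by exact_mod_cast (by omega))

lemma MetricGraph.isCompact_setOf_edist_le {G : SimpleGraph V}
    (hG : ∀ v, (G.neighborSet v).Finite) (x : MetricGraph G) (r : ℝ≥0∞) (hr : r ≠ ⊤) :
    IsCompact {y : MetricGraph G | edist y x ≤ r} := by
  obtain ⟨k, hk⟩ := ENNReal.exists_nat_gt hr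
  refine Set.Finite.isCompact ((SimpleGraph.finite_setOf_edist_le hG x k).subset fun y hy => ?_)
  have h : ((G.edist (V := V) y x : ℕ∞) : ℝ≥0∞) ≤ ((k : ℕ∞) : ℝ≥0∞) := by
    rw [ENat.toENNReal_coe]
    exact le_trans hy hk.le
  exact ENat.toENNReal_le.1 h

lemma MetricGraph.edist_ne_top {G : SimpleGraph V} (hG : G.Connected) (x y : MetricGraph G) :
    edist x y ≠ ⊤ := by
  rw [MetricGraph.edist_def, ne_eq, ENat.toENNReal_eq_top]
  exact (SimpleGraph.edist_ne_top_iff_reachable).2 (hG.preconnected _ _)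

end GraphMetric

/-! ### The Diestel–Leader graph is connected and locally finite. -/

section DiestelLeader

open TreeVertex

variable {n : ℕ}

lemma TreeVertex.parent_child (v : TreeVertex n) (d : Fin n) : (v.child d).parent = v :=
  ((TreeVertex.eq_parent_iff v _).2 ⟨d, rfl⟩).symm

lemma TreeVertex.exists_iterate_parent_eq (hn : 0 < n) (v : TreeVertex n) (k : ℕ) :
    ∃ w, parent^[k] w = v := by
  have h : Function.Surjective (parent (n := n)) := fun v => ⟨v.child ⟨0, hn⟩, v.parent_child _⟩
  exact h.iterate k v

/-- Climbing in the first tree can be synchronized with descending in the second, since the descent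
from `x.1.2` to `y.1.2` is the ancestor path of `y.1.2` reversed. -/
lemma diestelLeader_reachable_of_iterate_parent (k : ℕ)
    (x y : {x : TreeVertex n × TreeVertex n // x.1.height + x.2.height = 0})
    (h₁ : parent^[k] x.1.1 = y.1.1) (h₂ : parent^[k] y.1.2 = x.1.2) :
    (diestelLeader n).Reachable x y := by
  induction k generalizing x with
  | zero =>
    have : x = y := Subtype.ext (Prod.ext h₁ h₂.symm)
    rw [this]
  | succ k ih =>
    rw [Function.iterate_succ_apply'] at h₂
    rw [Function.iterate_succ_apply] at h₁
    have hz : x.1.1.parent.height + (parent^[k] y.1.2).height = 0 := by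
      have := congrArg height h₂
      rw [height_parent] at this
      rw [height_parent]
      have := x.2
      omega
    have hadj : (diestelLeader n).Adj x ⟨(x.1.1.parent, parent^[k] y.1.2), hz⟩ :=
      ⟨Or.inl rfl, Or.inr h₂.symm⟩
    exact hadj.reachable.trans (ih _ h₁ rfl)

/-- Three monotone paths suffice: climb in the first tree to the distinguished ray, descend there
towards `v'` and beyond while the second coordinate climbs to the ray, then climb back to `v'` while
descending to `w'`. -/
lemma diestelLeader_connected (hn : 0 < n) : (diestelLeader n).Connected := by
  have : Nonempty {x : TreeVertex n × TreeVertex n // x.1.height + x.2.height = 0} :=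
    ⟨⟨(ray hn 0, ray hn 0), by simp [ray]⟩⟩
  refine SimpleGraph.Connected.mk fun ⟨⟨v, w⟩, hvw⟩ ⟨⟨v', w'⟩, hvw'⟩ => ?_
  obtain ⟨t, ⟨k, hk, hkv⟩, ⟨k', hk', hkv'⟩⟩ :=
    ((eventually_iterate_parent hn v).and (eventually_iterate_parent hn v')).exists
  obtain ⟨s, ⟨l, hl, hlw⟩, ⟨l', hl', hlw'⟩⟩ :=
    ((eventually_iterate_parent hn w).and (eventually_iterate_parent hn w')).exists
  simp only at hvw hvw'
  obtain ⟨w₁, hw₁⟩ := exists_iterate_parent_eq hn w k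
  obtain ⟨v₁, hv₁⟩ := exists_iterate_parent_eq hn v' l'
  have hhw := congrArg height hw₁
  have hhv := congrArg height hv₁
  rw [height_iterate_parent] at hhw hhv
  let z₁ : {x : TreeVertex n × TreeVertex n // x.1.height + x.2.height = 0} :=
    ⟨(ray hn t, w₁), by simp only [ray]; omega⟩
  let z₂ : {x : TreeVertex n × TreeVertex n // x.1.height + x.2.height = 0} :=
    ⟨(v₁, ray hn s), by simp only [ray]; omega⟩
  have e₁ : (diestelLeader n).Reachable ⟨(v, w), hvw⟩ z₁ :=
    diestelLeader_reachable_of_iterate_parent k _ _ hkv hw₁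
  have e₂ : (diestelLeader n).Reachable z₂ z₁ := by
    refine diestelLeader_reachable_of_iterate_parent (k' + l') _ _ ?_ ?_
    · change parent^[k' + l'] v₁ = ray hn t
      rw [Function.iterate_add_apply, hv₁, hkv']
    · change parent^[k' + l'] w₁ = ray hn s
      -- Both sums equal `s + t`, because opposite heights cancel in each of the two vertices.
      have : k' + l' = l + k := by omega
      rw [this, Function.iterate_add_apply, hw₁, hlw]
  have e₃ : (diestelLeader n).Reachable z₂ ⟨(v', w'), hvw'⟩ :=
    diestelLeader_reachable_of_iterate_parent l' _ _ hv₁ hlw'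
  exact e₁.trans (e₂.symm.trans e₃)

lemma diestelLeader_finite_neighborSet
    (x : {x : TreeVertex n × TreeVertex n // x.1.height + x.2.height = 0}) :
    ((diestelLeader n).neighborSet x).Finite := by
  have h (v : TreeVertex n) : ((regularTree n).neighborSet v).Finite :=
    Set.finite_of_ncard_pos (by rw [regularTree_degree]; omega)
  exact (((h x.1.1).prod (h x.1.2)).preimage Subtype.val_injective.injOn).subset
    fun y hy => hy

end DiestelLeader

/-! ### A criterion for envelopes from transitive actions on two trees. -/

section OrbitMap

open TreeVertex

/-- A transitive action of a group `Γ` on `T_n` that permutes the horospheres, given by the orbit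
map of a vertex of height `0`. -/
structure TreeOrbitMap (Γ : Type*) [Group Γ] (n : ℕ) where
  toFun : Γ → TreeVertex n
  surjective : Function.Surjective toFun
  mul_congr : ∀ g γ δ, toFun γ = toFun δ → toFun (g * γ) = toFun (g * δ)
  up : Γ
  parent_eq : ∀ γ, (toFun γ).parent = toFun (γ * up)
  heightHom : Γ →* Multiplicative ℤ
  height_eq : ∀ γ, (toFun γ).height = (heightHom γ).toAdd

namespace TreeOrbitMap

variable {Γ : Type*} [Group Γ] {n : ℕ} (T : TreeOrbitMap Γ n)

/-- The action of `Γ` on the tree. -/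
noncomputable def act (g : Γ) (v : TreeVertex n) : TreeVertex n :=
  T.toFun (g * (T.surjective v).choose)

/-- `mul_congr` makes the chosen preimage in `act` irrelevant. With surjectivity, identities for the
action become identities in `Γ`. -/
lemma act_toFun (g γ : Γ) : T.act g (T.toFun γ) = T.toFun (g * γ) :=
  T.mul_congr _ _ _ (T.surjective (T.toFun γ)).choose_spec

lemma act_one (v : TreeVertex n) : T.act 1 v = v := by
  obtain ⟨γ, rfl⟩ := T.surjective v
  rw [act_toFun, one_mul]

lemma act_mul (g h : Γ) (v : TreeVertex n) : T.act (g * h) v = T.act g (T.act h v) := by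
  obtain ⟨γ, rfl⟩ := T.surjective v
  rw [act_toFun, act_toFun, act_toFun, mul_assoc]

/-- Passing to the parent is right multiplication by `up`, which commutes with the left action. -/
lemma act_parent (g : Γ) (v : TreeVertex n) : T.act g v.parent = (T.act g v).parent := by
  obtain ⟨γ, rfl⟩ := T.surjective v
  rw [parent_eq, act_toFun, act_toFun, parent_eq, mul_assoc]

lemma act_adj (g : Γ) {v w : TreeVertex n} (h : (regularTree n).Adj v w) :
    (regularTree n).Adj (T.act g v) (T.act g w) := by
  rcases h with h | h
  · exact Or.inl (by rw [h, act_parent])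
  · exact Or.inr (by rw [h, act_parent])

lemma height_act (g : Γ) (v : TreeVertex n) :
    (T.act g v).height = (T.heightHom g).toAdd + v.height := by
  obtain ⟨γ, rfl⟩ := T.surjective v
  rw [act_toFun, height_eq, height_eq, map_mul, toAdd_mul]

variable (T₁ T₂ : TreeOrbitMap Γ n)

/-- Two actions on `T_n` that shift the heights in opposite directions induce an action on the
vertices of `DL₂(n)`. -/
noncomputable def diestelLeaderPerm (hχ : ∀ γ, T₁.heightHom γ * T₂.heightHom γ = 1) :
    Γ →* Equiv.Perm {x : TreeVertex n × TreeVertex n // x.1.height + x.2.height = 0} :=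
  letI : MulAction Γ {x : TreeVertex n × TreeVertex n // x.1.height + x.2.height = 0} :=
    { smul := fun g x => ⟨(T₁.act g x.1.1, T₂.act g x.1.2), by
        have h1 := congrArg Multiplicative.toAdd (hχ g)
        have h2 := x.2
        rw [toAdd_mul, toAdd_one] at h1
        simp only [height_act]
        omega⟩
      one_smul := fun x => Subtype.ext (Prod.ext (T₁.act_one _) (T₂.act_one _))
      mul_smul := fun g h x => Subtype.ext (Prod.ext (T₁.act_mul _ _ _) (T₂.act_mul _ _ _)) }
  MulAction.toPermHom _ _

lemma diestelLeaderPerm_apply (hχ : ∀ γ, T₁.heightHom γ * T₂.heightHom γ = 1) (g : Γ)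
    (x : {x : TreeVertex n × TreeVertex n // x.1.height + x.2.height = 0}) :
    (diestelLeaderPerm T₁ T₂ hχ g x).1 = (T₁.act g x.1.1, T₂.act g x.1.2) := rfl

/-- The induced action on `DL₂(n)` by isometries. -/
noncomputable def diestelLeaderHom (hχ : ∀ γ, T₁.heightHom γ * T₂.heightHom γ = 1) :
    Γ →* (MetricGraph (diestelLeader n) ≃ᵢ MetricGraph (diestelLeader n)) :=
  isometryHomOfPermHom (diestelLeader n) (diestelLeaderPerm T₁ T₂ hχ)
    fun g _ _ h => ⟨T₁.act_adj g h.1, T₂.act_adj g h.2⟩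

/-- If `Γ` acts transitively on `DL₂(n)` and the stabilizer of a vertex acts on the plane with a
discrete and cobounded free orbit, then `Isom(ℝ²) × Isom(DL₂(n))` is an envelope of `Γ`. -/
theorem isCocompactEnvelope (hn : 0 < n)
    (hχ : ∀ γ, T₁.heightHom γ * T₂.heightHom γ = 1)
    (hT : ∀ v w : TreeVertex n, v.height + w.height = 0 →
      ∃ γ, T₁.toFun γ = v ∧ T₂.toFun γ = w)
    (α : Γ →* EuclideanSpace ℝ (Fin 2) ≃ᵢ EuclideanSpace ℝ (Fin 2))
    (hdisc : ∀ γ, T₁.toFun γ = T₁.toFun 1 → T₂.toFun γ = T₂.toFun 1 →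
      dist (α γ 0) 0 < 1 → γ = 1)
    (r : ℝ) (hcob : ∀ z, ∃ γ, T₁.toFun γ = T₁.toFun 1 ∧ T₂.toFun γ = T₂.toFun 1 ∧
      dist (α γ 0) z ≤ r) :
    IsCocompactEnvelope (IsomR2TimesIsomDL n) Γ := by
  have hE : ∀ r : ℝ≥0∞, r ≠ ⊤ → IsCompact {y : EuclideanSpace ℝ (Fin 2) | edist y 0 ≤ r} := by
    intro r hr
    lift r to NNReal using hr
    rw [show {y : EuclideanSpace ℝ (Fin 2) | edist y 0 ≤ r} = Metric.closedBall 0 r from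
      Set.ext fun y => by
        rw [Metric.mem_closedBall, dist_nndist, NNReal.coe_le_coe, ← ENNReal.coe_le_coe,
          ← edist_nndist]
        rfl]
    exact isCompact_closedBall _ _
  have hEf : ∀ x : EuclideanSpace ℝ (Fin 2), edist x 0 ≠ ⊤ := fun x => edist_ne_top _ _
  let o : MetricGraph (diestelLeader n) := (⟨(T₁.toFun 1, T₂.toFun 1), by
    simp [height_eq]⟩ : {x : TreeVertex n × TreeVertex n // x.1.height + x.2.height = 0})
  have hD := MetricGraph.isCompact_setOf_edist_le (diestelLeader_finite_neighborSet (n := n)) o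
  have hDf := fun x => MetricGraph.edist_ne_top (diestelLeader_connected hn) x o
  have := isometryGroup_locallyCompactSpace _ hE hEf
  have := isometryGroup_locallyCompactSpace _ hD hDf
  set β := diestelLeaderHom T₁ T₂ hχ with hβ
  have hβo : ∀ γ, (β γ o : {x : TreeVertex n × TreeVertex n // x.1.height + x.2.height = 0}).1 =
      (T₁.toFun γ, T₂.toFun γ) := fun γ => by
    change (diestelLeaderPerm T₁ T₂ hχ γ _).1 = _
    rw [diestelLeaderPerm_apply]
    rw [act_toFun, act_toFun, mul_one]
  have hstab : ∀ γ, β γ o = o ↔ T₁.toFun γ = T₁.toFun 1 ∧ T₂.toFun γ = T₂.toFun 1 := fun γ => by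
    rw [← Prod.mk_inj, ← hβo γ]
    exact Subtype.ext_iff
  let ι : Γ →* IsomR2TimesIsomDL n := α.prod β
  -- Distance less than `1` in a graph means equality, so `γ` fixes `o` and `hdisc` applies. This
  -- neighbourhood of the identity gives both injectivity and discreteness.
  have hι : ∀ γ, edist ((ι γ).1 0) 0 < 1 → edist ((ι γ).2 o) o < 1 → γ = 1 := by
    intro γ h1 h2
    obtain ⟨h3, h4⟩ := (hstab γ).1 (MetricGraph.eq_of_edist_lt_one h2)
    refine hdisc γ h3 h4 ?_
    rw [edist_dist, ← ENNReal.ofReal_one, ENNReal.ofReal_lt_ofReal_iff one_pos] at h1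
    exact h1
  have hinj : Function.Injective ι := by
    rw [injective_iff_map_eq_one]
    intro γ h
    have e1 : (ι γ).1 0 = 0 := by rw [h]; rfl
    have e2 : (ι γ).2 o = o := by rw [h]; rfl
    refine hι γ ?_ ?_
    · rw [e1]; simp
    · rw [e2]; simp
  have hdt : DiscreteTopology ι.range := by
    rw [discreteTopology_iff_isOpen_singleton_one, isOpen_induced_iff]
    refine ⟨{p | edist (p.1 0) 0 < 1} ∩ {p | edist (p.2 o) o < 1}, ?_, ?_⟩
    · refine (isOpen_lt ?_ continuous_const).inter (isOpen_lt ?_ continuous_const)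
      · exact ((continuous_isometry_apply _).comp continuous_fst).edist continuous_const
      · exact ((continuous_isometry_apply _).comp continuous_snd).edist continuous_const
    · ext ⟨p, γ, rfl⟩
      constructor
      · rintro ⟨h1, h2⟩
        have := hι γ h1 h2
        subst this
        exact Subtype.ext (map_one ι)
      · intro h
        have h : ι γ = 1 := congrArg Subtype.val h
        change edist ((ι γ).1 0) 0 < 1 ∧ edist ((ι γ).2 o) o < 1
        rw [h]
        exact ⟨by simp, by
          change edist o o < 1
          simp⟩
  refine ⟨inferInstance, inferInstance, inferInstance, ι, hinj, hdt, ?_, ?_⟩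
  · exact Subgroup.isClosed_of_discrete
  refine ⟨{f | edist (f 0) 0 ≤ ENNReal.ofReal r} ×ˢ {f | edist (f o) o ≤ 0},
    (isCompact_setOf_edist_isometry_le _ hE hEf ENNReal.ofReal_ne_top).prod
      (isCompact_setOf_edist_isometry_le _ hD hDf ENNReal.zero_ne_top), ?_⟩
  intro g
  let x : {x : TreeVertex n × TreeVertex n // x.1.height + x.2.height = 0} := g.2 o
  -- First match `g` on the base vertex by transitivity, then correct the error in the plane by an
  -- element `γ₂` of the stabilizer, which does not disturb the vertex.
  obtain ⟨γ₁, h1, h2⟩ := hT x.1.1 x.1.2 x.2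
  have hγ₁ : β γ₁ o = g.2 o := Subtype.ext (by rw [hβo, h1, h2])
  obtain ⟨γ₂, h3, h4, h5⟩ := hcob ((α γ₁)⁻¹ (g.1 0))
  have hγ₂ := (hstab γ₂).2 ⟨h3, h4⟩
  refine ⟨γ₁ * γ₂, (ι (γ₁ * γ₂))⁻¹ * g, ⟨?_, ?_⟩, by group⟩
  · change edist ((α (γ₁ * γ₂))⁻¹ (g.1 0)) 0 ≤ _
    rw [map_mul, mul_inv_rev, ← (α γ₂).edist_eq, edist_comm, edist_dist]
    change ENNReal.ofReal (dist _ (α γ₂ ((α γ₂)⁻¹ ((α γ₁)⁻¹ (g.1 0))))) ≤ _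
    rw [show α γ₂ ((α γ₂)⁻¹ ((α γ₁)⁻¹ (g.1 0))) = (α γ₁)⁻¹ (g.1 0) from
      (α γ₂).apply_symm_apply _]
    exact ENNReal.ofReal_le_ofReal h5
  · change edist ((β (γ₁ * γ₂))⁻¹ (g.2 o)) o ≤ 0
    rw [map_mul, mul_inv_rev, ← hγ₁]
    change edist ((β γ₂)⁻¹ ((β γ₁)⁻¹ (β γ₁ o))) o ≤ 0
    rw [show (β γ₁)⁻¹ (β γ₁ o) = o from (β γ₁).symm_apply_apply _]
    nth_rewrite 1 [← hγ₂]
    rw [show (β γ₂)⁻¹ (β γ₂ o) = o from (β γ₂).symm_apply_apply _]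
    simp

end TreeOrbitMap

end OrbitMap

/-! ### The lamplighter group times `ℤ²`. -/

section Lamplighter

variable {F : Type*} [Group F] {n : ℕ}

/-- The vertex of `T_n` given by the lamps of `w` at the positions `p i` with `i` below the height
`ε * w.right`. -/
noncomputable def wreathVertex (e : F ≃ Fin n) (p : ℤ ≃ ℤ) (ε : ℤ)
    (he : (e 1 : ℕ) = 0) (w : restrictedWreath F (Multiplicative ℤ)) : TreeVertex n where
  height := ε * w.1.right.toAdd
  digit := Finsupp.ofSupportFinite
    (fun i => if i < ε * w.1.right.toAdd then (e (w.1.left (.ofAdd (p i))) : ℕ) else 0) <| by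
      have hw : (Function.mulSupport w.1.left).Finite := w.2
      refine (hw.preimage (f := fun i => Multiplicative.ofAdd (p i))
        (Multiplicative.ofAdd.injective.comp p.injective).injOn).subset fun i hi h => ?_
      rw [Function.mem_support, h, he, ite_self] at hi
      exact hi rfl
  digit_lt i := by
    have h0 : 0 < n := (Nat.zero_le _).trans_lt (e 1).2
    rw [Finsupp.ofSupportFinite_coe]
    split_ifs
    · exact (e _).2
    · exact h0
  digit_eq_zero i hi := by
    rw [Finsupp.ofSupportFinite_coe, if_neg (not_lt.2 hi)]

variable (e : F ≃ Fin n) (p : ℤ ≃ ℤ) (ε : ℤ) (he : (e 1 : ℕ) = 0)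

lemma height_wreathVertex (w : restrictedWreath F (Multiplicative ℤ)) :
    (wreathVertex e p ε he w).height = ε * w.1.right.toAdd := rfl

lemma digit_wreathVertex (w : restrictedWreath F (Multiplicative ℤ)) (i : ℤ) :
    (wreathVertex e p ε he w).digit i =
      if i < ε * w.1.right.toAdd then (e (w.1.left (.ofAdd (p i))) : ℕ) else 0 := by
  simp only [wreathVertex, Finsupp.ofSupportFinite_coe]

/-- The condition `ε * ε = 1` recovers the position of the lamplighter from the height, and
injectivity of `e` recovers the visible lamps from the digits. -/
lemma wreathVertex_eq_iff (hε : ε * ε = 1) (w w' : restrictedWreath F (Multiplicative ℤ)) :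
    wreathVertex e p ε he w = wreathVertex e p ε he w' ↔ w.1.right = w'.1.right ∧
      ∀ i < ε * w.1.right.toAdd, w.1.left (.ofAdd (p i)) = w'.1.left (.ofAdd (p i)) := by
  constructor
  · intro h
    have h1 := congrArg TreeVertex.height h
    simp only [height_wreathVertex] at h1
    have h2 : w.1.right.toAdd = w'.1.right.toAdd := by
      have := congrArg (fun x => ε * x) h1
      simpa only [← mul_assoc, hε, one_mul] using this
    refine ⟨Multiplicative.toAdd.injective h2, fun i hi => ?_⟩
    have h3 := congrArg (fun v => v.digit i) h
    simp only [digit_wreathVertex, ← h2, if_pos hi] at h3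
    exact e.injective (Fin.ext h3)
  · rintro ⟨h1, h2⟩
    refine TreeVertex.ext (by simp only [height_wreathVertex, h1]) (Finsupp.ext fun i => ?_)
    simp only [digit_wreathVertex, ← h1]
    split_ifs with h
    · rw [h2 i h]
    · rfl

/-- The translation of the lamplighter. -/
def wreathShift (F : Type*) [Group F] (m : ℤ) : restrictedWreath F (Multiplicative ℤ) :=
  ⟨RegularWreathProduct.inl (.ofAdd m), by
    change (Function.mulSupport (1 : Multiplicative ℤ → F)).Finite
    simp⟩

/-- The action of `ℤ² × (F ≀ ℤ)` on one of the two trees. -/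
noncomputable def lamplighterOrbitMap (hε : ε * ε = 1) (hp : ∀ j m, p (j - ε * m) = p j - m)
    (hs : Function.Surjective (wreathVertex e p ε he)) :
    TreeOrbitMap (ZSqTimesLamplighter F) n where
  toFun γ := wreathVertex e p ε he γ.2
  surjective v := by
    obtain ⟨w, hw⟩ := hs v
    exact ⟨(1, w), hw⟩
  mul_congr g γ δ h := by
    rw [wreathVertex_eq_iff e p ε he hε] at h ⊢
    refine ⟨?_, fun i hi => ?_⟩
    · change g.2.1.right * γ.2.1.right = g.2.1.right * δ.2.1.right
      rw [h.1]
    · change i < ε * (g.2.1.right.toAdd + γ.2.1.right.toAdd) at hi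
      change g.2.1.left _ * γ.2.1.left (g.2.1.right⁻¹ * .ofAdd (p i)) =
        g.2.1.left _ * δ.2.1.left (g.2.1.right⁻¹ * .ofAdd (p i))
      -- `hp` turns the shift of lamps by `g` into a shift of digit positions by `ε` times as much,
      -- matching the change of height.
      have h1 : g.2.1.right⁻¹ * .ofAdd (p i) =
          Multiplicative.ofAdd (p (i - ε * g.2.1.right.toAdd)) := by
        rw [hp, sub_eq_neg_add]
        rfl
      rw [h1, h.2 _ (by linarith)]
  up := (1, wreathShift F (-ε))
  parent_eq γ := by
    have hh : ε * (γ.2 * wreathShift F (-ε)).1.right.toAdd = ε * γ.2.1.right.toAdd - 1 := by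
      change ε * (γ.2.1.right.toAdd + -ε) = _
      linear_combination -hε
    refine TreeVertex.ext ?_ (Finsupp.ext fun i => ?_)
    · rw [TreeVertex.height_parent]
      exact hh.symm
    · have hl : (γ.2 * wreathShift F (-ε)).1.left = γ.2.1.left := mul_one _
      change _ = (wreathVertex e p ε he (γ.2 * wreathShift F (-ε))).digit i
      rw [digit_wreathVertex, hh, hl]
      change (Finsupp.erase _ _) i = _
      rw [Finsupp.erase_apply, digit_wreathVertex, height_wreathVertex]
      split_ifs <;> first | rfl | omega
  heightHom :=
    { toFun := fun γ => .ofAdd (ε * γ.2.1.right.toAdd)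
      map_one' := by simp
      map_mul' := fun γ δ => by
        rw [← ofAdd_add, ← mul_add]
        rfl }
  height_eq γ := rfl

/-- The reflection that exchanges the nonnegative and the negative positions. -/
def flipPosition : ℤ ≃ ℤ where
  toFun i := -1 - i
  invFun i := -1 - i
  left_inv i := by ring
  right_inv i := by ring

/-- With the lamplighter at `h`, the first tree sees the positions below `h`. The second sees `-1 -
i` for `i < -h`, that is, the positions from `h` on. The two digit sequences thus prescribe
complementary sets of lamps and never conflict. -/
lemma exists_wreathVertex_eq (v w : TreeVertex n) (h : v.height + w.height = 0) :
    ∃ γ : restrictedWreath F (Multiplicative ℤ), wreathVertex e (Equiv.refl ℤ) 1 he γ = v ∧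
      wreathVertex e flipPosition (-1) he γ = w := by
  have h1 (d : Fin n) (hd : (d : ℕ) = 0) : e.symm d = 1 := by
    rw [Equiv.symm_apply_eq]
    exact Fin.ext (hd.trans he.symm)
  let l : Multiplicative ℤ → F := fun i => if i.toAdd < v.height
    then e.symm ⟨v.digit i.toAdd, v.digit_lt _⟩ else e.symm ⟨w.digit (-1 - i.toAdd), w.digit_lt _⟩
  have hl : (Function.mulSupport l).Finite := by
    refine ((v.digit.hasFiniteSupport.preimage (f := Multiplicative.toAdd)
      Multiplicative.toAdd.injective.injOn).union (w.digit.hasFiniteSupport.preimage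
      (f := fun i : Multiplicative ℤ => flipPosition i.toAdd)
      (flipPosition.injective.comp Multiplicative.toAdd.injective).injOn)).subset fun i hi => ?_
    by_contra hc
    simp only [Set.mem_union, Set.mem_preimage, Function.mem_support, not_or, not_not] at hc
    refine hi ?_
    simp only [l]
    split_ifs
    · exact h1 _ hc.1
    · exact h1 _ hc.2
  refine ⟨⟨⟨l, .ofAdd v.height⟩, hl⟩, TreeVertex.ext ?_ (Finsupp.ext fun i => ?_),
    TreeVertex.ext ?_ (Finsupp.ext fun i => ?_)⟩
  · simp [height_wreathVertex]
  · rw [digit_wreathVertex]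
    have := v.digit_eq_zero i
    simp only [toAdd_ofAdd, Equiv.refl_apply, one_mul, l]
    split_ifs with h
    · simp
    · exact (this (not_lt.1 h)).symm
  · simp only [height_wreathVertex, toAdd_ofAdd]
    omega
  · rw [digit_wreathVertex]
    have := w.digit_eq_zero i
    simp only [toAdd_ofAdd, flipPosition, Equiv.coe_fn_mk, l]
    split_ifs with h h'
    · omega
    · simp
    · exact (this (by omega)).symm

/-- A finite group of order `n` in bijection with the digits, the identity being `0`. -/
lemma exists_equiv_fin_map_one [Finite F] (h : Nat.card F = n) :
    ∃ e : F ≃ Fin n, (e 1 : ℕ) = 0 := by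
  have h0 : 0 < n := h ▸ Nat.card_pos
  let e := Finite.equivFinOfCardEq h
  exact ⟨e.trans (Equiv.swap (e 1) ⟨0, h0⟩), by simp⟩

/-- The integral points of the plane. -/
noncomputable def integralPoint : (Fin 2 → ℤ) →+ EuclideanSpace ℝ (Fin 2) where
  toFun a := WithLp.toLp 2 fun i => (a i : ℝ)
  map_zero' := by ext; simp
  map_add' a b := by ext; simp

/-- Translations of a normed space, as a homomorphism. -/
noncomputable def translationHom (E : Type*) [SeminormedAddCommGroup E] :
    Multiplicative E →* E ≃ᵢ E where
  toFun a := IsometryEquiv.addLeft a.toAdd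
  map_one' := IsometryEquiv.ext fun x => by simp
  map_mul' a b := IsometryEquiv.ext fun x => by
    change a.toAdd + b.toAdd + x = a.toAdd + (b.toAdd + x)
    rw [add_assoc]

theorem isCocompactEnvelope_lamplighter [Finite F] (hF : Nat.card F = n) :
    IsCocompactEnvelope (IsomR2TimesIsomDL n) (ZSqTimesLamplighter F) := by
  obtain ⟨e, he⟩ := exists_equiv_fin_map_one hF
  have h0 : 0 < n := hF ▸ Nat.card_pos
  have hs₁ : Function.Surjective (wreathVertex e (Equiv.refl ℤ) 1 he) := fun v => by
    obtain ⟨γ, h, -⟩ := exists_wreathVertex_eq e he v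
      -- Any vertex of opposite height would do as a partner; all digits zero is the simplest.
      ⟨-v.height, 0, fun _ => h0, fun _ _ => rfl⟩ (by simp)
    exact ⟨γ, h⟩
  have hs₂ : Function.Surjective (wreathVertex e flipPosition (-1) he) := fun v => by
    obtain ⟨γ, -, h⟩ := exists_wreathVertex_eq e he
      ⟨-v.height, 0, fun _ => h0, fun _ _ => rfl⟩ v (by simp)
    exact ⟨γ, h⟩
  let T₁ := lamplighterOrbitMap e (Equiv.refl ℤ) 1 he (by norm_num) (by simp) hs₁
  let T₂ := lamplighterOrbitMap e flipPosition (-1) he (by norm_num)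
    (fun j m => by simp only [flipPosition, Equiv.coe_fn_mk]; ring) hs₂
  let α : ZSqTimesLamplighter F →* EuclideanSpace ℝ (Fin 2) ≃ᵢ EuclideanSpace ℝ (Fin 2) :=
    ((translationHom _).comp integralPoint.toMultiplicative).comp (MonoidHom.fst _ _)
  have hα : ∀ γ, α γ 0 = integralPoint γ.1.toAdd := fun γ => add_zero _
  refine TreeOrbitMap.isCocompactEnvelope T₁ T₂ h0 (fun γ => ?_) ?_ α ?_ 2 ?_
  · change Multiplicative.ofAdd (1 * γ.2.1.right.toAdd + -1 * γ.2.1.right.toAdd) = 1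
    simp
  · intro v w h
    obtain ⟨γ, h1, h2⟩ := exists_wreathVertex_eq e he v w h
    exact ⟨(1, γ), h1, h2⟩
  · intro γ h1 h2 h3
    obtain ⟨h4, h5⟩ := (wreathVertex_eq_iff e _ _ he (by norm_num) γ.2 1).1 h1
    obtain ⟨-, h6⟩ := (wreathVertex_eq_iff e _ _ he (by norm_num) γ.2 1).1 h2
    have h7 : γ.2.1.right = 1 := h4
    refine Prod.ext (Multiplicative.toAdd.injective (funext fun i => ?_)) (Subtype.ext
      (RegularWreathProduct.ext (funext fun x => ?_) h4))
    · rw [hα, dist_zero_right] at h3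
      have h8 := (PiLp.norm_apply_le (integralPoint γ.1.toAdd) i).trans_lt h3
      change ‖((γ.1.toAdd i : ℤ) : ℝ)‖ < 1 at h8
      rw [Real.norm_eq_abs] at h8
      exact Int.abs_lt_one_iff.1 (by exact_mod_cast h8)
    -- With the lamplighter at `0`, the first tree controls the negative positions and the second
    -- one the others.
    · rcases lt_or_ge x.toAdd 0 with hx | hx
      · exact h5 x.toAdd (by rw [h7]; simpa using hx)
      · have := h6 (-1 - x.toAdd) (by rw [h7]; simp; omega)
        simpa [flipPosition] using this
  · intro z
    refine ⟨(.ofAdd fun i => ⌊z i⌋, 1), rfl, rfl, ?_⟩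
    rw [hα, EuclideanSpace.dist_eq, Fin.sum_univ_two]
    have h (i : Fin 2) : dist (integralPoint (fun i => ⌊z i⌋) i) (z i) ^ 2 ≤ 1 := by
      change dist ((⌊z i⌋ : ℤ) : ℝ) (z i) ^ 2 ≤ 1
      rw [Real.dist_eq, sq_abs]
      nlinarith [Int.floor_le (z i), Int.lt_floor_add_one (z i)]
    refine Real.sqrt_le_iff.2 ⟨by norm_num, ?_⟩
    have := h 0
    have := h 1
    change dist (integralPoint (fun i => ⌊z i⌋) 0) (z 0) ^ 2 +
      dist (integralPoint (fun i => ⌊z i⌋) 1) (z 1) ^ 2 ≤ _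
    linarith

end Lamplighter

/-! ### Digit expansions in base `η`, where `n η² - η + n = 0`. -/

section QuadraticDigits

open Polynomial

variable {n : ℕ} {η : ℂ}

/-- As `η` is not real, no nonzero rational polynomial of degree at most one vanishes at it, so `q =
n X² - X + n` divides `f` over `ℚ`. The middle coefficient makes `q` primitive, and Gauss's lemma
gives divisibility over `ℤ`. -/
lemma natCast_dvd_coeff_zero_of_aeval_eq_zero (hη : n * η ^ 2 - η + n = 0) (him : η.im ≠ 0)
    (f : ℤ[X]) (hf : aeval η f = 0) : (n : ℤ) ∣ f.coeff 0 := by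
  have hn : n ≠ 0 := by
    rintro rfl
    simp only [Nat.cast_zero, zero_mul, zero_sub, add_zero, neg_eq_zero] at hη
    simp [hη] at him
  let q : ℤ[X] := C (n : ℤ) * X ^ 2 + C (-1) * X + C (n : ℤ)
  have hq1 : q.coeff 1 = -1 := by simp [q]
  have hq0 : q.coeff 0 = n := by simp [q]
  have hprim : q.IsPrimitive := by
    intro r hr
    rw [Polynomial.C_dvd_iff_dvd_coeff] at hr
    have := hr 1
    rw [hq1] at this
    exact isUnit_of_dvd_unit this (by simp)
  have hqη : aeval η (q.map (Int.castRingHom ℚ)) = 0 := by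
    simp only [q, Polynomial.map_add, Polynomial.map_mul, Polynomial.map_pow, map_C, map_X]
    simp
    linear_combination hη
  have hdeg : (q.map (Int.castRingHom ℚ)).degree = 2 := by
    have : q.map (Int.castRingHom ℚ) = C (n : ℚ) * X ^ 2 + C (-1) * X + C (n : ℚ) := by
      simp [q]
    rw [this, degree_quadratic (by exact_mod_cast hn)]
  have hq0' : q.map (Int.castRingHom ℚ) ≠ 0 := by
    intro h
    rw [h] at hdeg
    simp at hdeg
  have hdvd : q.map (Int.castRingHom ℚ) ∣ f.map (Int.castRingHom ℚ) := by
    rw [← EuclideanDomain.mod_eq_zero]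
    set r := f.map (Int.castRingHom ℚ) % q.map (Int.castRingHom ℚ) with hr
    have hrd : r.degree < 2 := by
      rw [← hdeg]
      exact EuclideanDomain.mod_lt _ hq0'
    have hrη : aeval η r = 0 := by
      have h1 := congrArg (aeval η)
        (EuclideanDomain.div_add_mod (f.map (Int.castRingHom ℚ)) (q.map (Int.castRingHom ℚ)))
      rw [map_add, map_mul, hqη, zero_mul, zero_add] at h1
      rw [hr, h1]
      rw [← hf]
      exact aeval_map_algebraMap ℚ η f
    have hre : r = C (r.coeff 1) * X + C (r.coeff 0) :=
      eq_X_add_C_of_degree_le_one (Order.le_of_lt_succ hrd)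
    rw [hre] at hrη
    simp only [map_add, map_mul, aeval_C, aeval_X] at hrη
    have h1 : r.coeff 1 = 0 := by
      have := congrArg Complex.im hrη
      simpa [him] using this
    have h0 : r.coeff 0 = 0 := by
      have := congrArg Complex.re hrη
      simpa [h1] using this
    rw [hre, h1, h0]
    simp
  obtain ⟨g, rfl⟩ := hprim.dvd_of_fraction_map_dvd_fraction_map (K := ℚ) hdvd
  rw [mul_coeff_zero, hq0]
  exact dvd_mul_right _ _

lemma mem_adjoin_singleton_iff_exists_aeval {x : ℂ} :
    x ∈ Algebra.adjoin ℤ {η} ↔ ∃ f : ℤ[X], aeval η f = x := by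
  rw [Algebra.adjoin_singleton_eq_range_aeval]
  rfl

/-- This makes distinct digits in `{0, …, n - 1}` incongruent modulo `η ℤ[η]`. -/
lemma natCast_dvd_of_eq_mul (hη : n * η ^ 2 - η + n = 0) (him : η.im ≠ 0) (d : ℤ) {y : ℂ}
    (hy : y ∈ Algebra.adjoin ℤ {η}) (h : (d : ℂ) = η * y) : (n : ℤ) ∣ d := by
  obtain ⟨f, rfl⟩ := mem_adjoin_singleton_iff_exists_aeval.1 hy
  have := natCast_dvd_coeff_zero_of_aeval_eq_zero hη him (X * f - C d) (by simp [h])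
  simpa using this

/-- The equation reads `n = η (1 - n η)`, so multiples of `n` in the constant coefficient can be
carried to higher powers of `η`. -/
lemma exists_digit (hn : 0 < n) (hη : n * η ^ 2 - η + n = 0) {y : ℂ}
    (hy : y ∈ Algebra.adjoin ℤ {η}) :
    ∃ d : Fin n, ∃ z ∈ Algebra.adjoin ℤ {η}, y = (d : ℕ) + η * z := by
  have hmem : η ∈ Algebra.adjoin ℤ {η} := Algebra.self_mem_adjoin_singleton ℤ η
  obtain ⟨f, rfl⟩ := mem_adjoin_singleton_iff_exists_aeval.1 hy
  have hn' : (n : ℤ) ≠ 0 := by omega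
  have h0 := Int.emod_nonneg (f.coeff 0) hn'
  have h1 := Int.emod_lt_of_pos (f.coeff 0) (by omega : (0 : ℤ) < n)
  refine ⟨⟨(f.coeff 0 % n).toNat, by omega⟩,
    aeval η f.divX + (f.coeff 0 / n : ℤ) * (1 - n * η), ?_, ?_⟩
  · refine add_mem (mem_adjoin_singleton_iff_exists_aeval.2 ⟨_, rfl⟩)
      (mul_mem (intCast_mem _ _) (sub_mem (one_mem _) (mul_mem (natCast_mem _ _) hmem)))
  · have h2 : ((f.coeff 0 % n).toNat : ℂ) = ((f.coeff 0 % n : ℤ) : ℂ) := by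
      rw [← Int.cast_natCast, Int.toNat_of_nonneg h0]
    have h3 : ((f.coeff 0 : ℤ) : ℂ) = ((f.coeff 0 % n : ℤ) : ℂ) + n * ((f.coeff 0 / n : ℤ) : ℂ) := by
      exact_mod_cast (Int.emod_add_mul_ediv (f.coeff 0) n).symm
    have h4 : aeval η f = η * aeval η f.divX + ((f.coeff 0 : ℤ) : ℂ) := by
      conv_lhs => rw [← X_mul_divX_add f]
      simp
    simp only [h2]
    rw [h4, h3]
    linear_combination (f.coeff 0 / n : ℤ) * hη

/-- The point represented by the digits of a vertex. -/
noncomputable def digitSum (η : ℂ) (v : TreeVertex n) : ℂ := v.digit.sum fun i d => d * η ^ i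

lemma digitSum_child (v : TreeVertex n) (d : Fin n) :
    digitSum η (v.child d) = digitSum η v + (d : ℕ) * η ^ v.height := by
  have h := Finsupp.sum_update_add v.digit v.height (d : ℕ) (fun i d => (d : ℂ) * η ^ i)
    (by simp) (by intros; push_cast; ring)
  rw [v.digit_eq_zero v.height le_rfl] at h
  simpa [digitSum, TreeVertex.child] using h

lemma digitSum_eq_zero (v : TreeVertex n) (h : v.digit = 0) : digitSum η v = 0 := by
  rw [digitSum, h, Finsupp.sum_zero_index]

/-- The vertex `v` represents the coset of `x` modulo `η ^ v.height * ℤ[η]`. -/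
def Represents (η : ℂ) (v : TreeVertex n) (x : ℂ) : Prop :=
  (x - digitSum η v) * η ^ (-v.height) ∈ Algebra.adjoin ℤ {η}

lemma Represents.parent (h0 : η ≠ 0) {v : TreeVertex n} {x : ℂ} (h : Represents η v x) :
    Represents η v.parent x := by
  obtain ⟨d, hd⟩ := (TreeVertex.eq_parent_iff v.parent v).1 rfl
  have h1 := digitSum_child (η := η) v.parent d
  rw [hd, TreeVertex.height_parent] at h1
  rw [Represents, TreeVertex.height_parent]
  have h2 := add_mem (mul_mem h (Algebra.self_mem_adjoin_singleton ℤ η))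
    (natCast_mem (Algebra.adjoin ℤ {η}) (d : ℕ))
  convert h2 using 1
  rw [h1]
  have h3 : η ^ (v.height - 1) * (η ^ (-v.height) * η) = 1 := by
    rw [← zpow_add_one₀ h0, ← zpow_add₀ h0]
    simp
  have h4 : η ^ (-(v.height - 1)) = η ^ (-v.height) * η := by
    rw [← zpow_add_one₀ h0]
    congr 1
    ring
  rw [h4]
  linear_combination ((d : ℕ) : ℂ) * h3

lemma Represents.sub_mem {v w : TreeVertex n} {x y : ℂ} (hx : Represents η v x)
    (hy : Represents η w y) (hvw : v = w) :
    (x - y) * η ^ (-v.height) ∈ Algebra.adjoin ℤ {η} := by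
  subst hvw
  have := _root_.sub_mem hx hy
  convert this using 1
  ring

lemma Represents.of_sub_mem {v : TreeVertex n} {x y : ℂ} (hx : Represents η v x)
    (h : (x - y) * η ^ (-v.height) ∈ Algebra.adjoin ℤ {η}) : Represents η v y := by
  have := _root_.sub_mem hx h
  rw [Represents]
  convert this using 1
  ring

/-- Both vertices have a common ancestor on the distinguished ray. Descending from it, equal parents
force the next digits to be congruent modulo `η`, hence modulo `n`, hence equal. -/
lemma Represents.unique (hη : n * η ^ 2 - η + n = 0) (him : η.im ≠ 0) {v w : TreeVertex n}
    {x : ℂ} (hv : Represents η v x) (hw : Represents η w x) (hvw : v.height = w.height) :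
    v = w := by
  have h0 : η ≠ 0 := by
    rintro rfl
    simp at him
  rcases n.eq_zero_or_pos with rfl | hn
  · exact absurd (v.digit_lt 0) (by omega)
  obtain ⟨t, ⟨k, hk, hkv⟩, ⟨l, hl, hlw⟩⟩ := ((TreeVertex.eventually_iterate_parent hn v).and
    (TreeVertex.eventually_iterate_parent hn w)).exists
  obtain rfl : k = l := by omega
  have key := hkv.trans hlw.symm
  clear hkv hlw hk hl
  induction k generalizing v w with
  | zero => exact key
  | succ k ih =>
    rw [Function.iterate_succ_apply, Function.iterate_succ_apply] at key
    have hp := ih (hv.parent h0) (hw.parent h0)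
      (by rw [TreeVertex.height_parent, TreeVertex.height_parent, hvw]) key
    obtain ⟨d, hd⟩ := (TreeVertex.eq_parent_iff v.parent v).1 rfl
    obtain ⟨e, he⟩ := (TreeVertex.eq_parent_iff v.parent w).1 hp
    rw [← hd, ← he]
    have h1 := digitSum_child (η := η) v.parent d
    have h2 := digitSum_child (η := η) v.parent e
    rw [hd, TreeVertex.height_parent] at h1
    rw [he, TreeVertex.height_parent] at h2
    rw [Represents] at hv hw
    rw [← hvw] at hw
    have h3 := _root_.sub_mem hw hv
    have h4 : ((d : ℕ) - (e : ℕ) : ℤ) = η * ((x - digitSum η w) * η ^ (-v.height) -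
        (x - digitSum η v) * η ^ (-v.height)) := by
      rw [h1, h2]
      have h5 : η ^ (v.height - 1) * (η ^ (-v.height) * η) = 1 := by
        rw [← zpow_add_one₀ h0, ← zpow_add₀ h0]
        simp
      push_cast
      linear_combination ((e : ℕ) - (d : ℕ) : ℂ) * h5
    have h5 := natCast_dvd_of_eq_mul hη him _ h3 h4
    congr 1
    have hd' := d.2
    have he' := e.2
    have h6 : ((d : ℕ) - (e : ℕ) : ℤ) = 0 :=
      Int.eq_zero_of_abs_lt_dvd h5 (by rw [abs_lt]; omega)
    exact Fin.ext (by omega)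

lemma exists_mul_pow_mem_adjoin (h0 : η ≠ 0) {x : ℂ} (hx : x ∈ Algebra.adjoin ℤ {η, η⁻¹}) :
    ∃ m : ℕ, x * η ^ m ∈ Algebra.adjoin ℤ {η} := by
  have hmem : η ∈ Algebra.adjoin ℤ {η} := Algebra.self_mem_adjoin_singleton ℤ η
  induction hx using Algebra.adjoin_induction with
  | mem x hx =>
    rcases hx with rfl | rfl
    · exact ⟨0, by simp⟩
    · exact ⟨1, by simp [h0]⟩
  | algebraMap r => exact ⟨0, by simp⟩
  | add x y _ _ hx hy =>
    obtain ⟨m, hm⟩ := hx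
    obtain ⟨k, hk⟩ := hy
    refine ⟨m + k, ?_⟩
    have := add_mem (mul_mem hm (pow_mem hmem k)) (mul_mem hk (pow_mem hmem m))
    convert this using 1
    ring
  | mul x y _ _ hx hy =>
    obtain ⟨m, hm⟩ := hx
    obtain ⟨k, hk⟩ := hy
    refine ⟨m + k, ?_⟩
    have := mul_mem hm hk
    convert this using 1
    ring

/-- After clearing the denominator `η^m`, the vertex of height `-m` with zero digits represents `x`.
Extracting digits extends it as far down the tree as needed, and taking parents then adjusts the
height to `k`. -/
lemma exists_represents (hn : 0 < n) (hη : n * η ^ 2 - η + n = 0) (h0 : η ≠ 0) {x : ℂ}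
    (hx : x ∈ Algebra.adjoin ℤ {η, η⁻¹}) (k : ℤ) :
    ∃ v : TreeVertex n, v.height = k ∧ Represents η v x := by
  have hmem : η ∈ Algebra.adjoin ℤ {η} := Algebra.self_mem_adjoin_singleton ℤ η
  obtain ⟨m, hm⟩ := exists_mul_pow_mem_adjoin h0 hx
  have key (j : ℕ) : ∃ v : TreeVertex n, v.height = -m + j ∧ Represents η v x := by
    induction j with
    | zero =>
      refine ⟨⟨-m, 0, fun _ => hn, fun _ _ => rfl⟩, by simp, ?_⟩
      rw [Represents, digitSum_eq_zero _ rfl]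
      simpa using hm
    | succ j ih =>
      obtain ⟨v, hv, hr⟩ := ih
      obtain ⟨d, z, hz, h⟩ := exists_digit hn hη hr
      refine ⟨v.child d, ?_, ?_⟩
      · change v.height + 1 = _
        rw [hv]
        push_cast
        ring
      · rw [Represents, digitSum_child]
        convert hz using 1
        change _ * η ^ (-(v.height + 1)) = z
        refine mul_left_cancel₀ h0 ?_
        have h1 : η ^ (-(v.height + 1)) * η = η ^ (-v.height) := by
          rw [← zpow_add_one₀ h0]
          congr 1
          ring
        have h2 : η ^ v.height * η ^ (-v.height) = 1 := by
          rw [← zpow_add₀ h0]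
          simp
        linear_combination h + (x - digitSum η v - (d : ℕ) * η ^ v.height) * h1 -
          ((d : ℕ) : ℂ) * h2
  obtain ⟨v, hv, hr⟩ := key (k.natAbs + m)
  have key' (j : ℕ) : Represents η (TreeVertex.parent^[j] v) x := by
    induction j with
    | zero => exact hr
    | succ j ih =>
      rw [Function.iterate_succ_apply']
      exact ih.parent h0
  refine ⟨TreeVertex.parent^[(k.natAbs - k).toNat] v, ?_, key' _⟩
  rw [TreeVertex.height_iterate_parent, hv]
  omega

/-- The vertex of height `k` that represents `x`. -/
noncomputable def cosetVertex (hn : 0 < n) (hη : n * η ^ 2 - η + n = 0) (h0 : η ≠ 0) (k : ℤ)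
    (x : Algebra.adjoin ℤ {η, η⁻¹}) : TreeVertex n :=
  (exists_represents hn hη h0 x.2 k).choose

lemma cosetVertex_height (hn : 0 < n) (hη : n * η ^ 2 - η + n = 0) (h0 : η ≠ 0) (k : ℤ)
    (x : Algebra.adjoin ℤ {η, η⁻¹}) : (cosetVertex hn hη h0 k x).height = k :=
  (exists_represents hn hη h0 x.2 k).choose_spec.1

lemma cosetVertex_represents (hn : 0 < n) (hη : n * η ^ 2 - η + n = 0) (h0 : η ≠ 0) (k : ℤ)
    (x : Algebra.adjoin ℤ {η, η⁻¹}) : Represents η (cosetVertex hn hη h0 k x) x :=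
  (exists_represents hn hη h0 x.2 k).choose_spec.2

lemma cosetVertex_eq (hn : 0 < n) (hη : n * η ^ 2 - η + n = 0) (him : η.im ≠ 0) (h0 : η ≠ 0)
    {k : ℤ} {x : Algebra.adjoin ℤ {η, η⁻¹}} {v : TreeVertex n} (hk : v.height = k)
    (hv : Represents η v x) : cosetVertex hn hη h0 k x = v :=
  (cosetVertex_represents hn hη h0 k x).unique hη him hv
    ((cosetVertex_height hn hη h0 k x).trans hk.symm)

/-- This identifies the vertices of height `k` with the cosets of `η^k ℤ[η]`; all later statements
about the tree action reduce to it. -/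
lemma cosetVertex_eq_iff (hn : 0 < n) (hη : n * η ^ 2 - η + n = 0) (him : η.im ≠ 0) (h0 : η ≠ 0)
    (k l : ℤ) (x y : Algebra.adjoin ℤ {η, η⁻¹}) :
    cosetVertex hn hη h0 k x = cosetVertex hn hη h0 l y ↔
      k = l ∧ ((x : ℂ) - y) * η ^ (-k) ∈ Algebra.adjoin ℤ {η} := by
  have hx := cosetVertex_represents hn hη h0 k x
  have hy := cosetVertex_represents hn hη h0 l y
  constructor
  · intro h
    have h1 := congrArg TreeVertex.height h
    rw [cosetVertex_height, cosetVertex_height] at h1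
    have h2 := hx.sub_mem hy h
    rw [cosetVertex_height] at h2
    exact ⟨h1, h2⟩
  · rintro ⟨rfl, h⟩
    refine (cosetVertex_eq hn hη him h0 (cosetVertex_height hn hη h0 k x) ?_).symm
    refine hx.of_sub_mem ?_
    rwa [cosetVertex_height]

lemma cosetVertex_parent (hn : 0 < n) (hη : n * η ^ 2 - η + n = 0) (him : η.im ≠ 0) (h0 : η ≠ 0)
    (k : ℤ) (x : Algebra.adjoin ℤ {η, η⁻¹}) :
    (cosetVertex hn hη h0 k x).parent = cosetVertex hn hη h0 (k - 1) x := by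
  refine (cosetVertex_eq hn hη him h0 ?_ ((cosetVertex_represents hn hη h0 k x).parent h0)).symm
  rw [TreeVertex.height_parent, cosetVertex_height]

/-- A Laurent polynomial splits into its nonnegative and nonpositive powers. This is the source of
transitivity on pairs of vertices. -/
lemma exists_add_eq_of_mem_adjoin (h0 : η ≠ 0) {x : ℂ} (hx : x ∈ Algebra.adjoin ℤ {η, η⁻¹}) :
    ∃ y ∈ Algebra.adjoin ℤ {η}, ∃ z ∈ Algebra.adjoin ℤ {η⁻¹}, x = y + z := by
  obtain ⟨m, hm⟩ := exists_mul_pow_mem_adjoin h0 hx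
  obtain ⟨f, hf⟩ := mem_adjoin_singleton_iff_exists_aeval.1 hm
  have key (f : ℤ[X]) : ∃ y ∈ Algebra.adjoin ℤ {η}, ∃ z ∈ Algebra.adjoin ℤ {η⁻¹},
      aeval η f * (η⁻¹) ^ m = y + z := by
    induction f using Polynomial.induction_on' with
    | add p q hp hq =>
      obtain ⟨y, hy, z, hz, h⟩ := hp
      obtain ⟨y', hy', z', hz', h'⟩ := hq
      exact ⟨y + y', add_mem hy hy', z + z', add_mem hz hz', by
        rw [map_add, add_mul, h, h']
        ring⟩
    | monomial i a =>
      rw [aeval_monomial]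
      rcases le_total i m with h | h
      · obtain ⟨j, rfl⟩ := Nat.exists_eq_add_of_le h
        refine ⟨0, zero_mem _, a * (η⁻¹) ^ j, mul_mem (intCast_mem _ _)
          (pow_mem (Algebra.self_mem_adjoin_singleton ℤ _) _), ?_⟩
        rw [pow_add, zero_add, mul_assoc, ← mul_assoc (η ^ i), ← mul_pow, mul_inv_cancel₀ h0]
        simp
      · obtain ⟨j, rfl⟩ := Nat.exists_eq_add_of_le' h
        refine ⟨a * η ^ j, mul_mem (intCast_mem _ _)
          (pow_mem (Algebra.self_mem_adjoin_singleton ℤ _) _), 0, zero_mem _, ?_⟩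
        rw [pow_add, add_zero, mul_assoc, mul_assoc, ← mul_pow, mul_inv_cancel₀ h0]
        simp
  obtain ⟨y, hy, z, hz, h⟩ := key f
  refine ⟨y, hy, z, hz, ?_⟩
  rw [← h, hf, mul_assoc, ← mul_pow, mul_inv_cancel₀ h0, one_pow, mul_one]

/-- The elements of `ℤ[η] ∩ ℤ[η⁻¹]` lie in the lattice `ℤ + ℤ n η`. -/
lemma exists_eq_add_of_mem_of_mem (hη : n * η ^ 2 - η + n = 0) (him : η.im ≠ 0)
    {x : ℂ} (h₁ : x ∈ Algebra.adjoin ℤ {η}) (h₂ : x ∈ Algebra.adjoin ℤ {η⁻¹}) :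
    ∃ a b : ℤ, x = a + b * (n * η) := by
  have h0 : η ≠ 0 := by
    rintro rfl
    simp at him
  -- The equation is palindromic, so the divisibility lemma also applies to `η⁻¹`.
  have hη' : n * (η⁻¹) ^ 2 - η⁻¹ + n = 0 := by
    field_simp
    linear_combination hη
  have him' : (η⁻¹).im ≠ 0 := by
    rw [Complex.inv_im]
    exact div_ne_zero (neg_ne_zero.2 him) (by simpa using h0)
  have hmem' : η⁻¹ ∈ Algebra.adjoin ℤ {η⁻¹} := Algebra.self_mem_adjoin_singleton ℤ _
  have hnη : n * η ∈ Algebra.adjoin ℤ {η⁻¹} := by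
    have : n * η = 1 - n * η⁻¹ := by
      field_simp
      linear_combination hη
    rw [this]
    exact sub_mem (one_mem _) (mul_mem (natCast_mem _ _) hmem')
  -- Induction on the degree: membership in `ℤ[η⁻¹]` forces the leading coefficient to be divisible
  -- by `n`, so a multiple of the quadratic lowers the degree until it is at most one.
  have key (D : ℕ) (f : ℤ[X]) (hf : f.natDegree ≤ D + 1) (hx : aeval η f ∈ Algebra.adjoin ℤ {η⁻¹}) :
      ∃ a b : ℤ, aeval η f = a + b * (n * η) := by
    induction D generalizing f with
    | zero =>
      have hre : f = C (f.coeff 1) * X + C (f.coeff 0) :=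
        eq_X_add_C_of_natDegree_le_one hf
      have he : aeval η f = f.coeff 1 * η + f.coeff 0 := by
        conv_lhs => rw [hre]
        simp
      have h1 : ((f.coeff 1 : ℤ) : ℂ) = η⁻¹ * (aeval η f - f.coeff 0) := by
        rw [he]
        field_simp
        ring
      obtain ⟨e, hd⟩ := natCast_dvd_of_eq_mul hη' him' _
        (sub_mem hx (intCast_mem _ _)) h1
      refine ⟨f.coeff 0, e, ?_⟩
      rw [he, hd]
      push_cast
      ring
    | succ D ih =>
      have hsum : aeval η f = ∑ i ∈ Finset.range (D + 2), (f.coeff i : ℂ) * η ^ i +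
          f.coeff (D + 2) * η ^ (D + 2) := by
        rw [aeval_eq_sum_range' (Nat.lt_succ_of_le hf), Finset.sum_range_succ]
        simp
      have hlow : (∑ i ∈ Finset.range (D + 2), (f.coeff i : ℂ) * η ^ i) * (η⁻¹) ^ (D + 1) ∈
          Algebra.adjoin ℤ {η⁻¹} := by
        rw [Finset.sum_mul]
        refine sum_mem fun i hi => ?_
        obtain ⟨j, hj⟩ := Nat.exists_eq_add_of_le (Nat.lt_succ_iff.1 (Finset.mem_range.1 hi))
        rw [hj, pow_add, mul_assoc, ← mul_assoc (η ^ i), ← mul_pow, mul_inv_cancel₀ h0,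
          one_pow, one_mul]
        exact mul_mem (intCast_mem _ _) (pow_mem hmem' _)
      -- Scaling by `η⁻¹ ^ (D + 1)` moves all lower terms into `ℤ[η⁻¹]` and leaves the leading
      -- coefficient times `η`; hence that integer lies in `η⁻¹ ℤ[η⁻¹]`.
      have h1 : ((f.coeff (D + 2) : ℤ) : ℂ) = η⁻¹ * (aeval η f * (η⁻¹) ^ (D + 1) -
          (∑ i ∈ Finset.range (D + 2), (f.coeff i : ℂ) * η ^ i) * (η⁻¹) ^ (D + 1)) := by
        rw [← sub_mul, hsum, add_sub_cancel_left]
        have : η ^ (D + 2) * (η⁻¹ * η⁻¹ ^ (D + 1)) = 1 := by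
          rw [← pow_succ', ← mul_pow, mul_inv_cancel₀ h0, one_pow]
        linear_combination (-(f.coeff (D + 2) : ℂ)) * this
      obtain ⟨e, hd⟩ := natCast_dvd_of_eq_mul hη' him' _
        (sub_mem (mul_mem hx (pow_mem hmem' _)) hlow) h1
      let q : ℤ[X] := C (n : ℤ) * X ^ 2 - X + C (n : ℤ)
      have hq : aeval η q = 0 := by
        simp [q, hη]
      let g := f - C e * X ^ D * q
      have hg : aeval η g = aeval η f := by
        simp [g, hq]
      rw [← hg]
      refine ih g ?_ (by rwa [hg])
      rw [natDegree_le_iff_coeff_eq_zero]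
      intro N hN
      have hgc : g.coeff N = f.coeff N - (C e * X ^ D * q).coeff N := coeff_sub _ _ _
      obtain ⟨j, rfl⟩ := Nat.exists_eq_add_of_le (show D + 2 ≤ N by omega)
      have hqc : (C e * X ^ D * q).coeff (D + 2 + j) = e * q.coeff (2 + j) := by
        rw [mul_assoc, coeff_C_mul, show D + 2 + j = (2 + j) + D by ring, coeff_X_pow_mul]
      rw [hgc, hqc]
      rcases Nat.eq_zero_or_pos j with rfl | hj
      · have : q.coeff 2 = n := by
          simp [q, coeff_X]
        rw [add_zero, add_zero, this, hd]
        ring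
      · have h2 : q.coeff (2 + j) = 0 := by
          simp only [q, coeff_add, coeff_sub, coeff_C_mul, coeff_X_pow, coeff_X, coeff_C]
          rw [if_neg (by omega), if_neg (by omega), if_neg (by omega)]
          simp
        rw [h2, coeff_eq_zero_of_natDegree_lt (by omega)]
        simp
  obtain ⟨f, rfl⟩ := mem_adjoin_singleton_iff_exists_aeval.1 h₁
  exact key f.natDegree f (by omega) h₂

end QuadraticDigits

/-! ### The group `ℤ[1/n]² ⋊ ℤ` acting on the plane and on the two trees. -/

section ArithmeticGroup

variable (n : ℕ)

/-- The element `1 / n` of `ℤ[1/n]`. -/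
def invGen : ZInv n := ⟨(n : ℚ)⁻¹, Algebra.subset_adjoin rfl⟩

/-- Multiplication by `ζ` on `ℤ[1/n] + ℤ[1/n] ζ`, where `ζ ^ 2 - ζ / n + 1 = 0`. -/
def companionEquiv : (Fin 2 → ZInv n) ≃+ (Fin 2 → ZInv n) where
  toFun x := ![-x 1, x 0 + invGen n * x 1]
  invFun x := ![x 1 + invGen n * x 0, -x 0]
  left_inv x := by
    ext i
    fin_cases i <;> simp
  right_inv x := by
    ext i
    fin_cases i <;> simp
  map_add' x y := by
    ext i
    fin_cases i <;> simp <;> ring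

/-- The action of `ℤ` on `ℤ[1/n]²` by powers of the companion matrix. -/
def companionAction : Multiplicative ℤ →* MulAut (Multiplicative (Fin 2 → ZInv n)) :=
  zpowersHom _ (AddEquiv.toMultiplicative (companionEquiv n))

variable {n} (ζ : ℂ)

/-- The embedding of `ℤ[1/n]²` in `ℂ` with basis `1`, `ζ`. -/
noncomputable def planeHom : (Fin 2 → ZInv n) →+ ℂ where
  toFun x := ((x 0 : ℚ) : ℂ) + ((x 1 : ℚ) : ℂ) * ζ
  map_zero' := by simp
  map_add' x y := by
    simp
    ring

lemma planeHom_apply (x : Fin 2 → ZInv n) :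
    planeHom ζ x = ((x 0 : ℚ) : ℂ) + ((x 1 : ℚ) : ℂ) * ζ := rfl

variable {ζ}

lemma planeHom_injective (him : ζ.im ≠ 0) : Function.Injective (planeHom (n := n) ζ) := by
  rw [injective_iff_map_eq_zero]
  intro x hx
  rw [planeHom_apply] at hx
  have h1 : ((x 1 : ℚ) : ℝ) = 0 := by
    have := congrArg Complex.im hx
    simpa [him] using this
  have h0 : ((x 0 : ℚ) : ℝ) = 0 := by
    have := congrArg Complex.re hx
    simpa [h1] using this
  ext i
  fin_cases i
  · exact_mod_cast h0
  · exact_mod_cast h1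

lemma planeHom_companionEquiv (hn : 0 < n) (hζ : n * ζ ^ 2 - ζ + n = 0) (x : Fin 2 → ZInv n) :
    planeHom ζ (companionEquiv n x) = ζ * planeHom ζ x := by
  have hn' : (n : ℂ) ≠ 0 := by exact_mod_cast hn.ne'
  have h : ζ ^ 2 = (n : ℂ)⁻¹ * ζ - 1 := by
    field_simp
    linear_combination hζ
  have h0 : companionEquiv n x 0 = -x 1 := rfl
  have h1 : companionEquiv n x 1 = x 0 + invGen n * x 1 := rfl
  have h2 : ((invGen n : ℚ) : ℂ) = (n : ℂ)⁻¹ := by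
    simp [invGen]
  rw [planeHom_apply, planeHom_apply, h0, h1]
  push_cast
  rw [h2]
  linear_combination (-((x 1 : ℚ) : ℂ)) * h

lemma planeHom_companionAction (hn : 0 < n) (hζ : n * ζ ^ 2 - ζ + n = 0) (h0 : ζ ≠ 0)
    (m : Multiplicative ℤ) (x : Multiplicative (Fin 2 → ZInv n)) :
    planeHom ζ (companionAction n m x).toAdd = ζ ^ m.toAdd * planeHom ζ x.toAdd := by
  have h1 (x : Multiplicative (Fin 2 → ZInv n)) :
      planeHom ζ (companionAction n (.ofAdd 1) x).toAdd = ζ * planeHom ζ x.toAdd :=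
    planeHom_companionEquiv hn hζ _
  have h2 (x : Multiplicative (Fin 2 → ZInv n)) :
      planeHom ζ (companionAction n (.ofAdd (-1)) x).toAdd = ζ⁻¹ * planeHom ζ x.toAdd := by
    rw [eq_inv_mul_iff_mul_eq₀ h0, ← h1, ← MulAut.mul_apply, ← map_mul, ← ofAdd_add]
    simp
  obtain ⟨m, rfl⟩ := Multiplicative.ofAdd.surjective m
  rw [toAdd_ofAdd]
  induction m using Int.induction_on generalizing x with
  | zero => simp
  | succ i ih =>
    rw [ofAdd_add, map_mul, MulAut.mul_apply, ih, h1, zpow_add_one₀ h0]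
    ring
  | pred i ih =>
    rw [sub_eq_add_neg, ofAdd_add, map_mul, MulAut.mul_apply, ih, h2, ← sub_eq_add_neg,
      zpow_sub_one₀ h0]
    ring

/-- Dividing the equation by `n ζ` gives `1/n = ζ + ζ⁻¹`. -/
lemma ratCast_mem_adjoin (hn : 0 < n) (hζ : n * ζ ^ 2 - ζ + n = 0) (h0 : ζ ≠ 0) {q : ℚ}
    (hq : q ∈ ZInv n) : (q : ℂ) ∈ Algebra.adjoin ℤ {ζ, ζ⁻¹} := by
  induction hq using Algebra.adjoin_induction with
  | mem x hx =>
    obtain rfl : x = (n : ℚ)⁻¹ := hx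
    have hn' : (n : ℂ) ≠ 0 := by exact_mod_cast hn.ne'
    have : (((n : ℚ)⁻¹ : ℚ) : ℂ) = ζ + ζ⁻¹ := by
      push_cast
      field_simp
      linear_combination -hζ
    rw [this]
    exact add_mem (Algebra.subset_adjoin (by simp)) (Algebra.subset_adjoin (by simp))
  | algebraMap r => simp
  | add x y _ _ hx hy =>
    rw [Rat.cast_add]
    exact add_mem hx hy
  | mul x y _ _ hx hy =>
    rw [Rat.cast_mul]
    exact mul_mem hx hy

lemma planeHom_mem (hn : 0 < n) (hζ : n * ζ ^ 2 - ζ + n = 0) (h0 : ζ ≠ 0)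
    (x : Fin 2 → ZInv n) : planeHom ζ x ∈ Algebra.adjoin ℤ {ζ, ζ⁻¹} :=
  add_mem (ratCast_mem_adjoin hn hζ h0 (x 0).2) (mul_mem (ratCast_mem_adjoin hn hζ h0 (x 1).2)
    (Algebra.subset_adjoin (by simp)))

/-- The image of `planeHom` is a group containing `1` and stable under powers of `ζ`, hence all of
`ℤ[ζ, ζ⁻¹]`. -/
lemma exists_planeHom_eq (hn : 0 < n) (hζ : n * ζ ^ 2 - ζ + n = 0) (h0 : ζ ≠ 0) {y : ℂ}
    (hy : y ∈ Algebra.adjoin ℤ {ζ, ζ⁻¹}) : ∃ x : Fin 2 → ZInv n, planeHom ζ x = y := by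
  have hmul (m : ℤ) (x : Fin 2 → ZInv n) : ∃ x', planeHom ζ x' = ζ ^ m * planeHom ζ x :=
    ⟨_, planeHom_companionAction hn hζ h0 (.ofAdd m) (.ofAdd x)⟩
  obtain ⟨m, hm⟩ := exists_mul_pow_mem_adjoin h0 hy
  obtain ⟨f, hf⟩ := mem_adjoin_singleton_iff_exists_aeval.1 hm
  have key (f : Polynomial ℤ) : ∃ x : Fin 2 → ZInv n, planeHom ζ x = Polynomial.aeval ζ f := by
    induction f using Polynomial.induction_on' with
    | add p q hp hq =>
      obtain ⟨x, hx⟩ := hp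
      obtain ⟨x', hx'⟩ := hq
      exact ⟨x + x', by rw [map_add, hx, hx', map_add]⟩
    | monomial i a =>
      obtain ⟨x, hx⟩ := hmul i ![(a : ZInv n), 0]
      refine ⟨x, ?_⟩
      rw [hx, Polynomial.aeval_monomial, planeHom_apply]
      simp [mul_comm]
  obtain ⟨x, hx⟩ := key f
  obtain ⟨x', hx'⟩ := hmul (-m) x
  refine ⟨x', ?_⟩
  rw [hx', hx, hf, zpow_neg, zpow_natCast]
  field_simp

/-- The action of `ℤ[1/n]² ⋊ ℤ` on a tree, where `η = ζ ^ ε`. -/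
noncomputable def arithmeticOrbitMap (hn : 0 < n) (hζ : n * ζ ^ 2 - ζ + n = 0) (hζ0 : ζ ≠ 0)
    {η : ℂ} {ε : ℤ} (hε : ε * ε = 1) (hη : n * η ^ 2 - η + n = 0) (him : η.im ≠ 0) (h0 : η ≠ 0)
    (hηζ : ∀ m : ℤ, ζ ^ m = η ^ (ε * m))
    (hmem : ∀ x : Fin 2 → ZInv n, planeHom ζ x ∈ Algebra.adjoin ℤ {η, η⁻¹})
    (hs : ∀ v : TreeVertex n, ∃ x : Fin 2 → ZInv n, Represents η v (planeHom ζ x)) :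
    TreeOrbitMap (ZInvSqSemidirect n (companionAction n)) n where
  toFun γ := cosetVertex hn hη h0 (ε * γ.right.toAdd) ⟨_, hmem γ.left.toAdd⟩
  surjective v := by
    obtain ⟨x, hx⟩ := hs v
    refine ⟨⟨.ofAdd x, .ofAdd (ε * v.height)⟩, cosetVertex_eq hn hη him h0 ?_ hx⟩
    rw [toAdd_ofAdd, ← mul_assoc, hε, one_mul]
  mul_congr g γ δ h := by
    rw [cosetVertex_eq_iff hn hη him h0] at h ⊢
    simp only at h ⊢
    rw [SemidirectProduct.mul_left, SemidirectProduct.mul_left, SemidirectProduct.mul_right,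
      SemidirectProduct.mul_right, toAdd_mul, toAdd_mul, toAdd_mul, toAdd_mul, mul_add, mul_add,
      h.1]
    refine ⟨rfl, ?_⟩
    -- The action of `g` multiplies the difference of the translation parts by `η ^ (ε *
    -- g.right.toAdd)`, which the change of height exactly cancels.
    convert h.2 using 1
    rw [map_add, map_add, planeHom_companionAction hn hζ hζ0, planeHom_companionAction hn hζ hζ0,
      hηζ, h.1, neg_add, zpow_add₀ h0]
    have h1 : η ^ (ε * g.right.toAdd) * η ^ (-(ε * g.right.toAdd)) = 1 := by
      rw [← zpow_add₀ h0]
      simp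
    linear_combination (planeHom ζ γ.left.toAdd - planeHom ζ δ.left.toAdd) *
      η ^ (-(ε * δ.right.toAdd)) * h1
  up := ⟨1, .ofAdd (-ε)⟩
  parent_eq γ := by
    rw [cosetVertex_parent hn hη him h0, cosetVertex_eq_iff hn hη him h0]
    have h1 : (γ * (⟨1, .ofAdd (-ε)⟩ : ZInvSqSemidirect n (companionAction n))).left = γ.left := by
      rw [SemidirectProduct.mul_left]
      simp
    refine ⟨?_, ?_⟩
    · rw [SemidirectProduct.mul_right, toAdd_mul, toAdd_ofAdd]
      linear_combination hε
    · simp only [h1, sub_self, zero_mul, zero_mem]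
  heightHom :=
    { toFun := fun γ => .ofAdd (ε * γ.right.toAdd)
      map_one' := by simp
      map_mul' := fun γ δ => by
        rw [← ofAdd_add, ← mul_add, SemidirectProduct.mul_right, toAdd_mul] }
  height_eq γ := cosetVertex_height hn hη h0 _ _

/-- The action of `ℤ[1/n]² ⋊ ℤ` on the plane by translations and powers of the rotation `ζ`. -/
noncomputable def planeAction (hn : 0 < n) (ζ : Circle) (hζ : n * (ζ : ℂ) ^ 2 - ζ + n = 0) :
    ZInvSqSemidirect n (companionAction n) →* (ℂ ≃ᵢ ℂ) where
  toFun γ := (rotation (ζ ^ γ.right.toAdd)).toIsometryEquiv.trans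
    (IsometryEquiv.addLeft (planeHom ζ γ.left.toAdd))
  map_one' := IsometryEquiv.ext fun z => by simp
  map_mul' γ δ := IsometryEquiv.ext fun z => by
    change planeHom ζ (γ * δ).left.toAdd + ((ζ ^ (γ * δ).right.toAdd : Circle) : ℂ) * z =
      planeHom ζ γ.left.toAdd + ((ζ ^ γ.right.toAdd : Circle) : ℂ) *
        (planeHom ζ δ.left.toAdd + ((ζ ^ δ.right.toAdd : Circle) : ℂ) * z)
    rw [SemidirectProduct.mul_left, SemidirectProduct.mul_right, toAdd_mul, toAdd_mul, map_add,
      planeHom_companionAction hn hζ ζ.coe_ne_zero, zpow_add, Circle.coe_mul, Circle.coe_zpow]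
    ring

lemma planeAction_apply_zero (hn : 0 < n) (ζ : Circle) (hζ : n * (ζ : ℂ) ^ 2 - ζ + n = 0)
    (γ : ZInvSqSemidirect n (companionAction n)) :
    planeAction hn ζ hζ γ 0 = planeHom ζ γ.left.toAdd := by
  change planeHom ζ γ.left.toAdd + ((ζ ^ γ.right.toAdd : Circle) : ℂ) * 0 = _
  simp

/-- Conjugation of isometry groups by an isometry. -/
def isometryConj {X Y : Type*} [PseudoEMetricSpace X] [PseudoEMetricSpace Y] (e : X ≃ᵢ Y) :
    (X ≃ᵢ X) →* (Y ≃ᵢ Y) where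
  toFun f := (e.symm.trans f).trans e
  map_one' := IsometryEquiv.ext fun y => e.apply_symm_apply y
  map_mul' f g := IsometryEquiv.ext fun y => by
    change e (f (g (e.symm y))) = e (f (e.symm (e (g (e.symm y)))))
    rw [e.symm_apply_apply]

/-- The roots have sum `1/n` and product `1`, so they are conjugate points of the unit circle with
real part `1/(2n)`. -/
lemma exists_circle_root (hn : 0 < n) :
    ∃ ζ : Circle, n * (ζ : ℂ) ^ 2 - ζ + n = 0 ∧ (ζ : ℂ).im ≠ 0 := by
  have hn' : (1 : ℝ) ≤ n := by exact_mod_cast hn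
  have h1 : 0 < 1 - (1 / (2 * n : ℝ)) ^ 2 := by
    have h2 : 1 / (2 * n : ℝ) ≤ 1 / 2 := by gcongr; linarith
    have h3 : 0 ≤ 1 / (2 * n : ℝ) := by positivity
    nlinarith
  set s := Real.sqrt (1 - (1 / (2 * n : ℝ)) ^ 2) with hs
  have hs0 : 0 < s := Real.sqrt_pos.2 h1
  have hs2 : s ^ 2 = 1 - (1 / (2 * n : ℝ)) ^ 2 := Real.sq_sqrt h1.le
  refine ⟨⟨⟨1 / (2 * n), s⟩, mem_sphere_zero_iff_norm.2 ?_⟩, ?_, hs0.ne'⟩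
  · rw [← sq_eq_sq₀ (norm_nonneg _) zero_le_one, Complex.sq_norm,
      Complex.normSq_apply]
    simp only
    nlinarith
  · have hr : (1 / (2 * n : ℝ)) * n = 1 / 2 := by
      field_simp
    apply Complex.ext
    · simp only [pow_two, Complex.add_re, Complex.sub_re, Complex.mul_re, Complex.mul_im,
        Complex.natCast_re, Complex.natCast_im, Complex.zero_re]
      linear_combination (-n : ℝ) * hs2 + 2 * (1 / (2 * n : ℝ)) * hr
    · simp only [pow_two, Complex.add_im, Complex.sub_im, Complex.mul_re, Complex.mul_im,
        Complex.natCast_re, Complex.natCast_im, Complex.zero_im]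
      linear_combination 2 * s * hr

/-- Since `2 n Re ζ = 1`, the squared norm is the integer `a² + ab + n²b²`. -/
lemma eq_zero_of_norm_lt_one (hn : 0 < n) (ζ : Circle) (hζ : n * (ζ : ℂ) ^ 2 - ζ + n = 0)
    (a b : ℤ) (h : ‖(a : ℂ) + b * (n * ζ)‖ < 1) : (a : ℂ) + b * (n * ζ) = 0 := by
  have hn' : (0 : ℝ) < n := by exact_mod_cast hn
  have h1 : (ζ : ℂ).re ^ 2 + (ζ : ℂ).im ^ 2 = 1 := by
    have := Complex.sq_norm (ζ : ℂ)
    rw [Circle.norm_coe, Complex.normSq_apply] at this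
    linarith
  have h2 := congrArg Complex.re hζ
  have h3 := congrArg Complex.im hζ
  simp only [pow_two, Complex.add_re, Complex.sub_re, Complex.mul_re, Complex.mul_im,
    Complex.natCast_re, Complex.natCast_im, Complex.zero_re, Complex.add_im, Complex.sub_im,
    Complex.zero_im] at h2 h3
  -- On the unit circle the equation becomes `ζ (2 n Re ζ - 1) = 0`; `h5` and `h6` are its real and
  -- imaginary parts, and `h7` multiplies by the conjugate of `ζ`.
  have h4 : 2 * n * (ζ : ℂ).re = 1 := by
    have h5 : (ζ : ℂ).re * (2 * n * (ζ : ℂ).re - 1) = 0 := by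
      linear_combination h2 + (n : ℝ) * h1
    have h6 : (ζ : ℂ).im * (2 * n * (ζ : ℂ).re - 1) = 0 := by
      linear_combination h3
    have h7 : 2 * n * (ζ : ℂ).re - 1 = 0 := by
      linear_combination (-(2 * n * (ζ : ℂ).re - 1)) * h1 + (ζ : ℂ).re * h5 + (ζ : ℂ).im * h6
    linarith
  have h5 : ‖(a : ℂ) + b * (n * ζ)‖ ^ 2 = ((a ^ 2 + a * b + (b * n) ^ 2 : ℤ) : ℝ) := by
    rw [Complex.sq_norm, Complex.normSq_apply]
    simp only [Complex.add_re, Complex.mul_re, Complex.mul_im, Complex.add_im,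
      Complex.natCast_re, Complex.natCast_im, Complex.intCast_re, Complex.intCast_im]
    push_cast
    linear_combination (a * b : ℝ) * h4 + (b * n : ℝ) ^ 2 * h1
  have h6 : ((a ^ 2 + a * b + (b * n) ^ 2 : ℤ) : ℝ) < 1 := by
    rw [← h5]
    have := norm_nonneg ((a : ℂ) + b * (n * ζ))
    nlinarith
  have h7 : a ^ 2 + a * b + (b * n) ^ 2 < 1 := by exact_mod_cast h6
  have h8 : a ^ 2 + a * b + (b * n) ^ 2 = 0 := by
    have : (0 : ℝ) ≤ ((a ^ 2 + a * b + (b * n) ^ 2 : ℤ) : ℝ) := by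
      rw [← h5]
      positivity
    have : 0 ≤ a ^ 2 + a * b + (b * n) ^ 2 := by exact_mod_cast this
    omega
  rw [h8] at h5
  simpa using h5

theorem isCocompactEnvelope_arithmetic (hn : 0 < n) :
    IsCocompactEnvelope (IsomR2TimesIsomDL n) (ZInvSqSemidirect n (companionAction n)) := by
  obtain ⟨ζ, hζ, him⟩ := exists_circle_root hn
  have h0 : (ζ : ℂ) ≠ 0 := ζ.coe_ne_zero
  have hη : n * ((ζ : ℂ)⁻¹) ^ 2 - (ζ : ℂ)⁻¹ + n = 0 := by
    field_simp
    linear_combination hζ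
  have him' : ((ζ : ℂ)⁻¹).im ≠ 0 := by
    rw [Complex.inv_im]
    exact div_ne_zero (neg_ne_zero.2 him) (by simp)
  have hmem := fun x => planeHom_mem hn hζ h0 x
  have hmem' : ∀ x : Fin 2 → ZInv n,
      planeHom (ζ : ℂ) x ∈ Algebra.adjoin ℤ {(ζ : ℂ)⁻¹, (ζ : ℂ)⁻¹⁻¹} := fun x => by
    rw [inv_inv, Set.pair_comm]
    exact hmem x
  have hsum (η : ℂ) (v : TreeVertex n) (hζ' : η ∈ Algebra.adjoin ℤ {(ζ : ℂ), (ζ : ℂ)⁻¹})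
      (hζ'' : η⁻¹ ∈ Algebra.adjoin ℤ {(ζ : ℂ), (ζ : ℂ)⁻¹}) (k : ℤ) :
      η ^ k ∈ Algebra.adjoin ℤ {(ζ : ℂ), (ζ : ℂ)⁻¹} ∧
        digitSum η v ∈ Algebra.adjoin ℤ {(ζ : ℂ), (ζ : ℂ)⁻¹} := by
    have h (k : ℤ) : η ^ k ∈ Algebra.adjoin ℤ {(ζ : ℂ), (ζ : ℂ)⁻¹} := by
      rcases Int.eq_nat_or_neg k with ⟨m, rfl | rfl⟩
      · rw [zpow_natCast]
        exact pow_mem hζ' m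
      · rw [zpow_neg, zpow_natCast, ← inv_pow]
        exact pow_mem hζ'' m
    exact ⟨h k, sum_mem fun i _ => mul_mem (natCast_mem _ _) (h i)⟩
  have hm1 : (ζ : ℂ) ∈ Algebra.adjoin ℤ {(ζ : ℂ), (ζ : ℂ)⁻¹} := Algebra.subset_adjoin (by simp)
  have hm2 : (ζ : ℂ)⁻¹ ∈ Algebra.adjoin ℤ {(ζ : ℂ), (ζ : ℂ)⁻¹} := Algebra.subset_adjoin (by simp)
  -- With `a`, `b` the digit sums of `v`, `w` and `h = v.height`, the task is to solve `x ≡ a`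
  -- modulo `ζ^h ℤ[ζ]` and `x ≡ b` modulo `ζ^h ℤ[ζ⁻¹]`. Splitting `(a - b) ζ^(-h) = y + z` gives the
  -- solution `x = a - ζ^h y`.
  have hjoint (v w : TreeVertex n) (h : v.height + w.height = 0) : ∃ x : Fin 2 → ZInv n,
      Represents (ζ : ℂ) v (planeHom ζ x) ∧ Represents (ζ : ℂ)⁻¹ w (planeHom ζ x) := by
    obtain ⟨hz, hv⟩ := hsum ζ v hm1 hm2 (-v.height)
    obtain ⟨hz', hw⟩ := hsum (ζ : ℂ)⁻¹ w hm2 (by rwa [inv_inv]) w.height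
    obtain ⟨y, hy, z, hz, hyz⟩ := exists_add_eq_of_mem_adjoin h0 (mul_mem (sub_mem hv hw) hz)
    have hy' : y ∈ Algebra.adjoin ℤ {(ζ : ℂ), (ζ : ℂ)⁻¹} := Algebra.adjoin_mono (by simp) hy
    have h1 : (ζ : ℂ) ^ v.height * (ζ : ℂ) ^ (-v.height) = 1 := by
      rw [← zpow_add₀ h0]
      simp
    obtain ⟨x, hx⟩ := exists_planeHom_eq hn hζ h0
      (sub_mem hv (mul_mem (hsum ζ v hm1 hm2 v.height).1 hy'))
    refine ⟨x, ?_, ?_⟩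
    · rw [Represents, hx]
      convert neg_mem hy using 1
      linear_combination (-y) * h1
    · rw [Represents, hx]
      convert hz using 1
      rw [inv_zpow', neg_neg, show w.height = -v.height by omega]
      linear_combination hyz - y * h1
  let T₁ := arithmeticOrbitMap hn hζ h0 (ε := 1) (by norm_num) hζ him h0 (by simp) hmem fun v => by
    obtain ⟨x, hx, -⟩ := hjoint v ⟨-v.height, 0, fun _ => hn, fun _ _ => rfl⟩ (by simp)
    exact ⟨x, hx⟩
  let T₂ := arithmeticOrbitMap hn hζ h0 (ε := -1) (by norm_num) hη him' (inv_ne_zero h0)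
    (by simp) hmem' fun v => by
    obtain ⟨x, -, hx⟩ := hjoint ⟨-v.height, 0, fun _ => hn, fun _ _ => rfl⟩ v (by simp)
    exact ⟨x, hx⟩
  have hT₁ : ∀ γ, T₁.toFun γ = T₁.toFun 1 ↔
      γ.right = 1 ∧ planeHom (ζ : ℂ) γ.left.toAdd ∈ Algebra.adjoin ℤ {(ζ : ℂ)} := fun γ => by
    refine (cosetVertex_eq_iff hn hζ him h0 _ _ _ _).trans ?_
    have h1 : (1 * γ.right.toAdd =
        1 * (1 : ZInvSqSemidirect n (companionAction n)).right.toAdd) ↔ γ.right = 1 := by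
      simp
    rw [h1]
    refine and_congr_right fun h => ?_
    simp [h]
  have hT₂ : ∀ γ, T₂.toFun γ = T₂.toFun 1 ↔
      γ.right = 1 ∧ planeHom (ζ : ℂ) γ.left.toAdd ∈ Algebra.adjoin ℤ {(ζ : ℂ)⁻¹} := fun γ => by
    refine (cosetVertex_eq_iff hn hη him' (inv_ne_zero h0) _ _ _ _).trans ?_
    have h1 : (-1 * γ.right.toAdd =
        -1 * (1 : ZInvSqSemidirect n (companionAction n)).right.toAdd) ↔ γ.right = 1 := by
      simp
    rw [h1]
    refine and_congr_right fun h => ?_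
    simp [h]
  let L := Complex.orthonormalBasisOneI.repr
  have hα : ∀ γ, ((isometryConj L.toIsometryEquiv).comp (planeAction hn ζ hζ)) γ 0 =
      L (planeHom ζ γ.left.toAdd) := fun γ => by
    change L (planeAction hn ζ hζ γ (L.symm 0)) = _
    rw [map_zero, planeAction_apply_zero]
  refine TreeOrbitMap.isCocompactEnvelope T₁ T₂ hn (fun γ => ?_) ?_
    ((isometryConj L.toIsometryEquiv).comp (planeAction hn ζ hζ)) ?_ (n + 1) ?_
  · change Multiplicative.ofAdd (1 * γ.right.toAdd + -1 * γ.right.toAdd) = 1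
    simp
  · intro v w h
    obtain ⟨x, hx, hx'⟩ := hjoint v w h
    refine ⟨⟨.ofAdd x, .ofAdd v.height⟩, cosetVertex_eq hn hζ him h0 (one_mul _).symm hx,
      cosetVertex_eq hn hη him' (inv_ne_zero h0) ?_ hx'⟩
    rw [toAdd_ofAdd]
    omega
  · intro γ h1 h2 h3
    rw [hα, dist_zero_right, LinearIsometryEquiv.norm_map] at h3
    rw [hT₁] at h1
    rw [hT₂] at h2
    obtain ⟨a, b, hab⟩ := exists_eq_add_of_mem_of_mem hζ him h1.2 h2.2
    rw [hab] at h3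
    rw [eq_zero_of_norm_lt_one hn ζ hζ a b h3] at hab
    refine SemidirectProduct.ext ?_ h1.1
    exact Multiplicative.toAdd.injective (planeHom_injective him (hab.trans (map_zero _).symm))
  · intro z
    obtain ⟨z, rfl⟩ := L.surjective z
    have hn' : (0 : ℝ) < n := by exact_mod_cast hn
    have hnim : (n : ℝ) * (ζ : ℂ).im ≠ 0 := mul_ne_zero hn'.ne' him
    -- Rounding to the lattice `ℤ + ℤ n ζ`: `b` fixes the imaginary part up to `n |Im ζ| ≤ n`, then
    -- `a` the real part up to `1`, whence the radius `n + 1`.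
    set b := ⌊z.im / (n * (ζ : ℂ).im)⌋ with hb
    set a := ⌊(z - b * (n * ζ)).re⌋ with ha
    have hO : (a : ℂ) + b * (n * ζ) ∈ Algebra.adjoin ℤ {(ζ : ℂ)} :=
      add_mem (intCast_mem _ _) (mul_mem (intCast_mem _ _)
        (mul_mem (natCast_mem _ _) (Algebra.self_mem_adjoin_singleton ℤ _)))
    have hO' : (a : ℂ) + b * (n * ζ) ∈ Algebra.adjoin ℤ {(ζ : ℂ)⁻¹} := by
      have : n * (ζ : ℂ) = 1 - n * (ζ : ℂ)⁻¹ := by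
        field_simp
        linear_combination hζ
      rw [this]
      exact add_mem (intCast_mem _ _) (mul_mem (intCast_mem _ _) (sub_mem (one_mem _)
        (mul_mem (natCast_mem _ _) (Algebra.self_mem_adjoin_singleton ℤ _))))
    obtain ⟨x, hx⟩ := exists_planeHom_eq hn hζ h0 (Algebra.adjoin_mono (by simp) hO)
    refine ⟨⟨.ofAdd x, 1⟩, (hT₁ _).2 ⟨rfl, ?_⟩, (hT₂ _).2 ⟨rfl, ?_⟩, ?_⟩
    · rwa [toAdd_ofAdd, hx]
    · rwa [toAdd_ofAdd, hx]
    · rw [hα, L.dist_map, toAdd_ofAdd, hx, dist_comm, dist_eq_norm]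
      refine (Complex.norm_le_abs_re_add_abs_im _).trans ?_
      have h1 : (z - (a + b * (n * ζ))).re = Int.fract (z - b * (n * ζ)).re := by
        rw [Int.fract, ← ha]
        simp
        ring
      have h2 : (z - (a + b * (n * ζ))).im =
          Int.fract (z.im / (n * (ζ : ℂ).im)) * (n * (ζ : ℂ).im) := by
        rw [Int.fract, ← hb, sub_mul, div_mul_cancel₀ _ hnim]
        simp
      have h3 : |(ζ : ℂ).im| ≤ 1 := (Complex.abs_im_le_norm _).trans (Circle.norm_coe ζ).le
      rw [h1, h2, abs_mul, abs_mul, Int.abs_fract, Int.abs_fract, abs_of_pos hn']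
      have h4 := (Int.fract_lt_one (z - b * (n * ζ)).re).le
      have h5 := (Int.fract_lt_one (z.im / (n * (ζ : ℂ).im))).le
      have h6 : Int.fract (z.im / (n * (ζ : ℂ).im)) * (n * |(ζ : ℂ).im|) ≤ 1 * (n * 1) := by
        gcongr
      linarith

end ArithmeticGroup

/-! ### Finite generation, solvability and finite rank of the arithmetic group. -/

section FinitenessProperties

variable {n : ℕ}

/-- The companion matrix plus its inverse is the scalar `1/n`, so invariance under both yields
invariance under `ℤ[1/n]`. -/
lemma smul_mem_of_companionEquiv_mem (B : AddSubgroup (Fin 2 → ZInv n))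
    (h₁ : ∀ x ∈ B, companionEquiv n x ∈ B) (h₂ : ∀ x ∈ B, (companionEquiv n).symm x ∈ B)
    (q : ZInv n) {x : Fin 2 → ZInv n} (hx : x ∈ B) : q • x ∈ B := by
  obtain ⟨q, hq⟩ := q
  induction hq using Algebra.adjoin_induction generalizing x with
  | mem q hq =>
    obtain rfl : q = (n : ℚ)⁻¹ := hq
    convert add_mem (h₁ x hx) (h₂ x hx) using 1
    ext i
    fin_cases i
    · change _ = ((-x 1 + (x 1 + invGen n * x 0) : ZInv n) : ℚ)
      simp [invGen]
    · change _ = ((x 0 + invGen n * x 1 + -x 0 : ZInv n) : ℚ)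
      simp [invGen]
  | algebraMap r =>
    convert zsmul_mem hx r using 1
    ext i
    simp
  | add q q' hq hq' h h' =>
    convert add_mem (h hx) (h' hx) using 1
    rw [← add_smul]
    rfl
  | mul q q' hq hq' h h' =>
    convert h (h' hx) using 1
    rw [smul_smul]
    rfl

/-- The first basis vector and the generator of `ℤ` suffice: conjugation applies the companion
matrix, which sends the first basis vector to the second and generates the scalars `ℤ[1/n]`. -/
theorem fg_arithmetic : Group.FG (ZInvSqSemidirect n (companionAction n)) := by
  classical
  let e : Multiplicative (Fin 2 → ZInv n) := .ofAdd ![1, 0]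
  let t : Multiplicative ℤ := .ofAdd 1
  let S : Finset (ZInvSqSemidirect n (companionAction n)) :=
    {SemidirectProduct.inl e, SemidirectProduct.inr t}
  let H := Subgroup.closure (S : Set (ZInvSqSemidirect n (companionAction n)))
  have he : SemidirectProduct.inl e ∈ H := Subgroup.subset_closure (by simp [S])
  have ht : SemidirectProduct.inr t ∈ H := Subgroup.subset_closure (by simp [S])
  let B : AddSubgroup (Fin 2 → ZInv n) :=
    { carrier := {x | SemidirectProduct.inl (.ofAdd x) ∈ H}
      zero_mem' := by
        change SemidirectProduct.inl 1 ∈ H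
        rw [map_one]
        exact one_mem _
      add_mem' := fun {x y} hx hy => by
        change SemidirectProduct.inl (.ofAdd x * .ofAdd y) ∈ H
        rw [map_mul]
        exact mul_mem hx hy
      neg_mem' := fun {x} hx => by
        change SemidirectProduct.inl (.ofAdd x)⁻¹ ∈ H
        rw [map_inv]
        exact inv_mem hx }
  have hφ (x : Multiplicative (Fin 2 → ZInv n)) :
      companionAction n t x = .ofAdd (companionEquiv n x.toAdd) := by
    simp [companionAction, t]
  have h₁ : ∀ x ∈ B, companionEquiv n x ∈ B := fun x hx => by
    change SemidirectProduct.inl (.ofAdd (companionEquiv n x)) ∈ H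
    have := SemidirectProduct.inl_aut (φ := companionAction n) t (.ofAdd x)
    rw [hφ] at this
    rw [toAdd_ofAdd] at this
    rw [this]
    exact mul_mem (mul_mem ht hx) (by rw [map_inv]; exact inv_mem ht)
  have h₂ : ∀ x ∈ B, (companionEquiv n).symm x ∈ B := fun x hx => by
    change SemidirectProduct.inl (.ofAdd ((companionEquiv n).symm x)) ∈ H
    have := SemidirectProduct.inl_aut (φ := companionAction n) t
      (.ofAdd ((companionEquiv n).symm x))
    rw [hφ, toAdd_ofAdd, AddEquiv.apply_symm_apply] at this
    have h3 : SemidirectProduct.inl (.ofAdd ((companionEquiv n).symm x)) =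
        (SemidirectProduct.inr t)⁻¹ * SemidirectProduct.inl (.ofAdd x) *
          (SemidirectProduct.inr t : ZInvSqSemidirect n (companionAction n)) := by
      rw [this, map_inv]
      group
    rw [h3]
    exact mul_mem (mul_mem (inv_mem ht) hx) ht
  have heB : ![1, 0] ∈ B := he
  have hB (x : Fin 2 → ZInv n) : x ∈ B := by
    have h1 := smul_mem_of_companionEquiv_mem B h₁ h₂ (x 0) heB
    have h2 := smul_mem_of_companionEquiv_mem B h₁ h₂ (x 1) (h₁ _ heB)
    convert add_mem h1 h2 using 1
    ext i
    fin_cases i <;> simp [companionEquiv]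
  refine ⟨⟨S, ?_⟩⟩
  rw [eq_top_iff]
  rintro γ -
  rw [← SemidirectProduct.inl_left_mul_inr_right γ]
  refine mul_mem (hB γ.left.toAdd) ?_
  have : γ.right = t ^ γ.right.toAdd := by
    apply Multiplicative.toAdd.injective
    simp [t]
  rw [this, map_zpow]
  exact zpow_mem ht _

lemma isSolvable_semidirectProduct {N G : Type*} [CommGroup N] [CommGroup G] (φ : G →* MulAut N) :
    Group.IsSolvable (N ⋊[φ] G) :=
  Group.isSolvable_of_ker_le_range SemidirectProduct.inl SemidirectProduct.rightHom
    SemidirectProduct.range_inl_eq_ker_rightHom.ge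

/-- A finitely generated subgroup of `ℤ[1/n]²` can be generated by two elements. -/
lemma exists_card_le_two_subset_iff (s : Finset (Fin 2 → ZInv n)) :
    ∃ t : Finset (Fin 2 → ZInv n), t.card ≤ 2 ∧
      ∀ K : AddSubgroup (Fin 2 → ZInv n), (t : Set (Fin 2 → ZInv n)) ⊆ K ↔
        (s : Set (Fin 2 → ZInv n)) ⊆ K := by
  classical
  let M := Submodule.span ℤ (s : Set (Fin 2 → ZInv n))
  let b := Module.Free.chooseBasis ℤ M
  let f : (Fin 2 → ZInv n) →ₗ[ℤ] (Fin 2 → ℚ) :=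
    (ZInv n).val.toLinearMap.compLeft (Fin 2)
  have hf : Function.Injective f := by
    intro x y h
    ext i
    simpa [f] using congrFun h i
  have hli : LinearIndependent ℤ fun i => f (b i : Fin 2 → ZInv n) := by
    have h1 := b.linearIndependent.map' M.subtype (Submodule.ker_subtype M)
    exact h1.map' f (LinearMap.ker_eq_bot.2 hf)
  -- Vectors of `ℚ²` independent over `ℤ` are independent over `ℚ`, so the free module has rank at
  -- most `2`.
  rw [LinearIndependent.iff_fractionRing ℤ ℚ] at hli
  have hcard := hli.fintype_card_le_finrank
  rw [Module.finrank_fin_fun] at hcard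
  refine ⟨Finset.univ.image fun i => (b i : Fin 2 → ZInv n), Finset.card_image_le.trans hcard,
    fun K => ?_⟩
  have hspan : Submodule.span ℤ (Set.range fun i => (b i : Fin 2 → ZInv n)) = M := by
    have := congrArg (Submodule.map M.subtype) b.span_eq
    rw [Submodule.map_span, ← Set.range_comp, Submodule.map_top, Submodule.range_subtype] at this
    exact this
  rw [Finset.coe_image, Finset.coe_univ, Set.image_univ]
  have h1 := Submodule.span_le (R := ℤ) (s := (s : Set (Fin 2 → ZInv n)))
    (p := AddSubgroup.toIntSubmodule K)
  have h2 := Submodule.span_le (R := ℤ) (s := Set.range fun i => (b i : Fin 2 → ZInv n))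
    (p := AddSubgroup.toIntSubmodule K)
  rw [hspan] at h2
  exact h2.symm.trans h1

/-- The image of `H` in `ℤ` is cyclic, generated by the image of some `h ∈ H`. Correcting each
generator by a power of `h` moves it into `ℤ[1/n]²`, where two elements generate the same subgroup
as the corrected generators; with `h` this makes three. -/
theorem hasFiniteRank_semidirect
    (φ : Multiplicative ℤ →* MulAut (Multiplicative (Fin 2 → ZInv n))) :
    HasFiniteRank (ZInvSqSemidirect n φ) := by
  classical
  refine ⟨3, fun H ⟨S, hS⟩ => ?_⟩
  obtain ⟨⟨_, h, hh, rfl⟩, hgen⟩ :=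
    IsCyclic.exists_generator (α := H.map (SemidirectProduct.rightHom (φ := φ)))
  have hex (s : ZInvSqSemidirect n φ) : ∃ (v : Fin 2 → ZInv n) (k : ℤ), s ∈ H →
      SemidirectProduct.inl (.ofAdd v) * h ^ k = s := by
    by_cases hs : s ∈ H
    · obtain ⟨k, hk⟩ := Subgroup.mem_zpowers_iff.1 (hgen ⟨_, s, hs, rfl⟩)
      have hk : SemidirectProduct.rightHom h ^ k = SemidirectProduct.rightHom s :=
        congrArg Subtype.val hk
      have hker : s * (h ^ k)⁻¹ ∈ (SemidirectProduct.rightHom (φ := φ)).ker := by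
        rw [MonoidHom.mem_ker, map_mul, map_inv, map_zpow, hk, mul_inv_cancel]
      rw [← SemidirectProduct.range_inl_eq_ker_rightHom] at hker
      obtain ⟨v, hv⟩ := hker
      exact ⟨v.toAdd, k, fun _ => by rw [ofAdd_toAdd, hv]; group⟩
    -- Junk values outside `H`, so that `v` and `k` are total functions.
    · exact ⟨0, 0, fun h => absurd h hs⟩
  choose v k hvk using hex
  obtain ⟨t, ht, hK⟩ := exists_card_le_two_subset_iff (S.image v)
  let K (L : Subgroup (ZInvSqSemidirect n φ)) : AddSubgroup (Fin 2 → ZInv n) :=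
    Subgroup.toAddSubgroup' (L.comap SemidirectProduct.inl)
  let T : Finset (ZInvSqSemidirect n φ) :=
    insert h (t.image fun x => SemidirectProduct.inl (.ofAdd x))
  have hSH : ∀ s ∈ S, s ∈ H := fun s hs => hS ▸ Subgroup.subset_closure hs
  refine ⟨T, (Finset.card_insert_le _ _).trans (Nat.succ_le_succ (Finset.card_image_le.trans ht)),
    le_antisymm ?_ ?_⟩
  · rw [Subgroup.closure_le]
    have hsub : ((S.image v : Finset _) : Set (Fin 2 → ZInv n)) ⊆ K H := by
      intro x hx
      obtain ⟨s, hs, rfl⟩ := Finset.mem_image.1 hx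
      change SemidirectProduct.inl (.ofAdd (v s)) ∈ H
      rw [eq_mul_inv_of_mul_eq (hvk s (hSH s hs))]
      exact mul_mem (hSH s hs) (inv_mem (zpow_mem hh _))
    intro x hx
    rcases Finset.mem_insert.1 hx with rfl | hx
    · exact hh
    · obtain ⟨y, hy, rfl⟩ := Finset.mem_image.1 hx
      exact (hK (K H)).2 hsub hy
  · conv_lhs => rw [← hS]
    rw [Subgroup.closure_le]
    have hsub : (t : Set (Fin 2 → ZInv n)) ⊆ K (Subgroup.closure (T : Set _)) := fun x hx =>
      Subgroup.subset_closure
        (Finset.mem_coe.2 (Finset.mem_insert_of_mem (Finset.mem_image_of_mem _ hx)))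
    intro s hs
    rw [← hvk s (hSH s hs)]
    exact mul_mem ((hK _).1 hsub (Finset.mem_coe.2 (Finset.mem_image_of_mem v hs)))
      (zpow_mem (Subgroup.subset_closure (Finset.mem_coe.2 (Finset.mem_insert_self _ _))) _)

end FinitenessProperties

/-! ### The wreath product is finitely generated, and not virtually solvable for non-solvable lamps.
-/

section Wreath

/-- A group with infinitely many commuting copies of a finite non-solvable group is not virtually
solvable. -/
theorem not_isVirtuallySolvable_of_commute {F G ι : Type*} [Group F] [Finite F] [Group G]
    [Infinite ι] (e : ι → F →* G) (he : ∀ i, Function.Injective (e i))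
    (hcomm : ∀ i j, i ≠ j → ∀ a b, Commute (e i a) (e j b)) (hF : ¬ Group.IsSolvable F) :
    ¬ IsVirtuallySolvable G := by
  rintro ⟨H, hH, hfin⟩
  let N := H.normalCore
  have : Finite (F →* G ⧸ N) := Finite.of_injective _ DFunLike.coe_injective
  obtain ⟨i, j, hij, h⟩ :=
    -- There are only finitely many homomorphisms from `F` to the finite quotient `G ⧸ N`, so two
    -- copies of `F` have the same image. The copies commute, hence the image is abelian and `e i`
    -- maps `commutator F` into `N`.
    Finite.exists_ne_map_eq_of_infinite fun i => (QuotientGroup.mk' N).comp (e i)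
  have hij' (a : F) : QuotientGroup.mk' N (e i a) = QuotientGroup.mk' N (e j a) :=
    DFunLike.congr_fun h a
  have hle : commutator F ≤ H.comap (e i) := by
    have h1 : commutator F ≤ ((QuotientGroup.mk' N).comp (e i)).ker := by
      rw [commutator_def, Subgroup.commutator_le]
      intro a _ b _
      rw [MonoidHom.mem_ker, map_commutatorElement, commutatorElement_eq_one_iff_mul_comm]
      simp only [MonoidHom.comp_apply]
      rw [hij' b, ← map_mul, (hcomm i j hij a b).eq, map_mul]
    refine h1.trans fun a ha => ?_
    have : e i a ∈ N := (QuotientGroup.eq_one_iff _).1 ha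
    exact H.normalCore_le this
  let f : commutator F →* H :=
    ((e i).comp (commutator F).subtype).codRestrict H fun a => hle a.2
  have hf : Function.Injective f := fun a b hab =>
    Subtype.ext (he i (congrArg Subtype.val hab))
  have : Group.IsSolvable (commutator F) := Group.isSolvable_of_isSolvable_injective hf
  refine hF (Group.isSolvable_of_ker_le_range (commutator F).subtype
    (Abelianization.of (G := F)) ?_)
  rw [Abelianization.ker_of, Subgroup.range_subtype]

variable {F : Type*} [Group F]

/-- The copy of `F` in `F ≀ ℤ` at the position `i`. -/
def wreathSingle (i : Multiplicative ℤ) : F →* restrictedWreath F (Multiplicative ℤ) where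
  toFun a := ⟨⟨Pi.mulSingle i a, 1⟩,
    (Set.finite_singleton i).subset Pi.mulSupport_mulSingle_subset⟩
  map_one' := Subtype.ext (RegularWreathProduct.ext (Pi.mulSingle_one i) rfl)
  map_mul' a b := by
    refine Subtype.ext (RegularWreathProduct.ext ?_ (one_mul 1).symm)
    change Pi.mulSingle i (a * b) =
      Pi.mulSingle i a * fun x => (Pi.mulSingle i b : Multiplicative ℤ → F) (1⁻¹ * x)
    simp [Pi.mulSingle_mul]

lemma wreathSingle_injective (i : Multiplicative ℤ) :
    Function.Injective (wreathSingle (F := F) i) := fun a b h => by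
  have := congrArg (fun w : restrictedWreath F (Multiplicative ℤ) => w.1.left i) h
  simpa [wreathSingle] using this

lemma wreathSingle_commute {i j : Multiplicative ℤ} (hij : i ≠ j) (a b : F) :
    Commute (wreathSingle i a) (wreathSingle j b) := by
  refine Subtype.ext (RegularWreathProduct.ext ?_ rfl)
  have := (Pi.mulSingle_commute (f := fun _ : Multiplicative ℤ => F) hij a b).eq
  change Pi.mulSingle i a * (fun x => (Pi.mulSingle j b : Multiplicative ℤ → F) (1⁻¹ * x)) =
    Pi.mulSingle j b * fun x => (Pi.mulSingle i a : Multiplicative ℤ → F) (1⁻¹ * x)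
  simpa using this

theorem not_isVirtuallySolvable_lamplighter [Finite F] (hF : ¬ Group.IsSolvable F) :
    ¬ IsVirtuallySolvable (ZSqTimesLamplighter F) :=
  not_isVirtuallySolvable_of_commute
    (fun i : Multiplicative ℤ => (MonoidHom.inr _ _).comp (wreathSingle i))
    (fun i => fun _ _ h => wreathSingle_injective i (congrArg Prod.snd h))
    (fun _ _ hij a b => (wreathSingle_commute hij a b).map (MonoidHom.inr _ _)) hF

lemma wreathShift_mul_wreathSingle (m : ℤ) (a : F) :
    wreathShift F m * wreathSingle 1 a * wreathShift F (-m) = wreathSingle (.ofAdd m) a := by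
  refine Subtype.ext (RegularWreathProduct.ext (funext fun x => ?_) ?_)
  · change 1 * (Pi.mulSingle 1 a : Multiplicative ℤ → F) ((Multiplicative.ofAdd m)⁻¹ * x) * 1 =
      (Pi.mulSingle (Multiplicative.ofAdd m) a : Multiplicative ℤ → F) x
    rw [one_mul, mul_one, Pi.mulSingle_apply, Pi.mulSingle_apply]
    exact if_congr (by rw [inv_mul_eq_one, eq_comm]) rfl rfl
  · change Multiplicative.ofAdd (m + 0 + -m) = 1
    simp

/-- Conjugates of the copy of `F` at the origin by shifts give the copies at all positions. A
finitely supported configuration is a finite product of those, removed one lamp at a time. -/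
theorem fg_restrictedWreath [Finite F] : Group.FG (restrictedWreath F (Multiplicative ℤ)) := by
  let S : Set (restrictedWreath F (Multiplicative ℤ)) :=
    insert (wreathShift F 1) (Set.range (wreathSingle 1))
  let H := Subgroup.closure S
  refine Group.fg_iff.2 ⟨S, ?_, (Set.finite_range _).insert _⟩
  have hshift (m : ℤ) : wreathShift F m ∈ H := by
    have h1 : wreathShift F 1 ∈ H := Subgroup.subset_closure (Set.mem_insert _ _)
    have h2 : wreathShift F m = wreathShift F 1 ^ m := by
      have h3 : (RegularWreathProduct.inl (D := F) (Multiplicative.ofAdd m)) =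
          RegularWreathProduct.inl (Multiplicative.ofAdd 1) ^ m := by
        rw [← map_zpow, ← ofAdd_zsmul, smul_eq_mul, mul_one]
      exact Subtype.ext h3
    rw [h2]
    exact zpow_mem h1 m
  have hsingle (i : Multiplicative ℤ) (a : F) : wreathSingle i a ∈ H := by
    rw [← ofAdd_toAdd i, ← wreathShift_mul_wreathSingle]
    exact mul_mem (mul_mem (hshift _) (Subgroup.subset_closure
      (Set.mem_insert_of_mem _ ⟨a, rfl⟩))) (hshift _)
  have hbase (s : Finset (Multiplicative ℤ)) (w : restrictedWreath F (Multiplicative ℤ))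
      (hw : w.1.right = 1) (hs : Function.mulSupport w.1.left ⊆ s) : w ∈ H := by
    classical
    induction s using Finset.induction_on generalizing w with
    | empty =>
      have : w = 1 := Subtype.ext (RegularWreathProduct.ext
        (Function.mulSupport_eq_empty_iff.1 (Set.subset_empty_iff.1 (by simpa using hs))) hw)
      rw [this]
      exact one_mem _
    | insert i s hi ih =>
      have h1 : ((wreathSingle i (w.1.left i))⁻¹ * w).1.left =
          fun x => ((Pi.mulSingle i (w.1.left i) : Multiplicative ℤ → F) x)⁻¹ * w.1.left x := by
        rw [← map_inv]
        funext x
        change (Pi.mulSingle i (w.1.left i)⁻¹ : Multiplicative ℤ → F) x * w.1.left (1⁻¹ * x) = _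
        rw [inv_one, one_mul, Pi.mulSingle_inv]
        rfl
      have h2 := ih ((wreathSingle i (w.1.left i))⁻¹ * w) (by
          change 1⁻¹ * w.1.right = 1
          rw [hw]
          rfl) fun x hx => by
        rw [h1, Function.mem_mulSupport] at hx
        rcases eq_or_ne x i with rfl | hxi
        · simp at hx
        · rw [Pi.mulSingle_eq_of_ne hxi, inv_one, one_mul] at hx
          have := hs hx
          simpa [hxi] using this
      have h3 := mul_mem (hsingle i (w.1.left i)) h2
      rwa [mul_inv_cancel_left] at h3
  rw [eq_top_iff]
  rintro w -
  have hw : (Function.mulSupport w.1.left).Finite := w.2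
  have h1 := hbase hw.toFinset (w * wreathShift F (-w.1.right.toAdd))
    (by
      change Multiplicative.ofAdd (w.1.right.toAdd + -w.1.right.toAdd) = 1
      simp)
    (by
      have : (w * wreathShift F (-w.1.right.toAdd)).1.left = w.1.left := mul_one _
      rw [this]
      simp)
  have h2 := mul_mem h1 (hshift w.1.right.toAdd)
  have h3 : wreathShift F (-w.1.right.toAdd) * wreathShift F w.1.right.toAdd = 1 := by
    have h4 : RegularWreathProduct.inl (D := F) (Multiplicative.ofAdd (-w.1.right.toAdd)) *
        RegularWreathProduct.inl (Multiplicative.ofAdd w.1.right.toAdd) = 1 := by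
      rw [← map_mul, ← ofAdd_add]
      simp
    exact Subtype.ext h4
  rwa [mul_assoc, h3, mul_one] at h2

end Wreath

theorem theorem3 :
    (∀ n : ℕ, 2 ≤ n →
      ∃ φ : Multiplicative ℤ →* MulAut (Multiplicative (Fin 2 → ZInv n)),
        Group.FG (ZInvSqSemidirect n φ) ∧
        ∀ (F : Type*) [Group F] [Finite F], Nat.card F = n →
          IsCocompactEnvelope (IsomR2TimesIsomDL n) (ZInvSqSemidirect n φ) ∧
          IsCocompactEnvelope (IsomR2TimesIsomDL n) (ZSqTimesLamplighter F)) ∧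
    (∃ (Γ Λ : Type) (_ : Group Γ) (_ : Group Λ),
      Group.FG Γ ∧ Group.FG Λ ∧ Group.IsSolvable Γ ∧ HasFiniteRank Γ ∧
        ¬ IsVirtuallySolvable Λ ∧ ShareCocompactEnvelope Γ Λ) := by
  constructor
  · intro n hn
    have hn : 0 < n := by omega
    exact ⟨companionAction n, fg_arithmetic, fun F _ _ hF =>
      ⟨isCocompactEnvelope_arithmetic hn, isCocompactEnvelope_lamplighter hF⟩⟩
  -- A finite non-solvable group is needed, and `n` is taken to be its order so that both groups lie
  -- in the same envelope.
  · have hn : 0 < Nat.card (Equiv.Perm (Fin 5)) := Nat.card_pos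
    have := fg_restrictedWreath (F := Equiv.Perm (Fin 5))
    exact ⟨ZInvSqSemidirect _ (companionAction _), ZSqTimesLamplighter (Equiv.Perm (Fin 5)), _, _,
      fg_arithmetic, inferInstance, isSolvable_semidirectProduct _, hasFiniteRank_semidirect _,
      not_isVirtuallySolvable_lamplighter Equiv.Perm.not_isSolvable_fin_5,
      IsomR2TimesIsomDL _, inferInstance, inferInstance, isCocompactEnvelope_arithmetic hn,
      isCocompactEnvelope_lamplighter rfl⟩
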